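/- **Setting.** For possibly undefined expressions, $e'\preceq e$ means: if $e$ is defined, then so is $e'$, and $e'\le e$; a statement $e\le x$ or $e\subseteq X$ includes the claim that $e$ is defined. A *partial applicative poset* (PAP) is a poset $A$ with a partial binary application such that $a'\le a$, $b'\le b$ imply $a'b'\preceq ab$. A *filter* of it is a non-empty, upwards closed subset closed under defined application; $\langle X\rangle$ is the smallest filter containing the non-empty set $X$. A *partial applicative structure* (PAS) is a PAP with a chosen filter $A^\#$. A *PCA* is a PAS $A$ with chosen $\mathsf k,\mathsf s\in A^\#$ such that $\mathsf kab\le a$, $\mathsf sab$ is defined and $\mathsf sabc\preceq ac(bc)$ for all $a,b,c\in A$. In a PCA put $\mathsf i=\mathsf{skk}$, $\top=\mathsf k$, $\bot=\overline{\mathsf k}=\mathsf{ki}$ and, with the standard bracket abstraction $\lambda^*$, $\mathsf p=\lambda^*xyz.zxy$, $\mathsf p_0=\lambda^*x.x\mathsf k$, $\mathsf p_1=\lambda^*x.x\overline{\mathsf k}$. Numerals are $\overline 0=\mathsf i$, $\overline{n+1}=\mathsf p\bot\overline n$, and $[a_0,\dots,a_{n-1}]=\mathsf p\,\overline n\,(\mathsf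 pa_0(\mathsf pa_1(\cdots(\mathsf pa_{n-1}\mathsf i))))$. The PCA $A$ is *semitrivial* if $\top$ and $\bot$ have a common lower bound; assume throughout that $A$ is a PCA that is **not** semitrivial. Let $\mathcal BA$ be the set of partial functions $\alpha\colon A\rightharpoonup A$ such that $a\le b$ implies $\alpha(a)\preceq\alpha(b)$, ordered by $\alpha\le\beta$ iff $\alpha(a)\preceq\beta(a)$ for all $a$; $\hat a\in\mathcal BA$ is the constant function with value $a$. For partial functions $q,g\colon A\rightharpoonup A$ and $b,c\in A$ write $q[g](b)=c$ if there are $u_0,\dots,u_{n-1}\in A$ ($n\ge 0$) such that $\mathsf p_0\cdot q([b,u_0,\dots,u_{m-1}])\le\bot$ and $g(\mathsf p_1\cdot q([b,u_0,\dots,u_{m-1}]))=u_m$ for all $m<n$, while $\mathsf p_0\cdot q([b,u_0,\dots,u_{n-1}])\le\top$ and $\mathsf p_1\cdot q([b,u_0,\dots,u_{n-1}])=c$. (There is at most one such $c$.) * $\mathcal BA$ is a PAP with the total application $\alpha\beta(a)\simeq\alpha[\beta](a)$; $(\mathcal BA)^\#$ is the set of $\alpha\in\mathcal BA$ that are effectively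 representable in $A$, i.e. for which some $r\in A^\#$ satisfies $ra\preceq\alpha(a)$ for all $a\in A$. * For $f\in\mathcal BA$, $A[f]$ is the poset $A$ with the application $a\odot b\simeq(\lambda x.ax)[f](b)$ and with $A[f]^\#$ the filter generated by $A^\#$ with respect to $\odot$. * $\mathcal BA[f]$ is the PAP $\mathcal BA$ with the filter $\langle(\mathcal BA)^\#\cup\{f\}\rangle$. Let $DB$ be the set of downsets of $B$; for $\beta,\gamma\in DB$, the product $\beta\cdot\gamma$ is defined iff $bc$ is defined for all $b\in\beta$, $c\in\gamma$, and is then the downset generated by these $bc$; for $s\in B$, $s\cdot\gamma$ means ${\downarrow}\{s\}\cdot\gamma$. A *partial applicative morphism* $g\colon A\rightharpoonup B$ is a map $g\colon A\to DB$ such that (1) $g(a)\cap B^\#\ne\emptyset$ for $a\in A^\#$; (2) some $t\in B^\#$ satisfies $t\cdot g(a)\cdot g(a')\subseteq g(aa')$ whenever $aa'$ is defined; (3) for some $w\in B^\#$, $w\cdot g(a)$ is defined for all $a$ and $w\cdot g(a)\subseteq g(a')$ whenever $a\le a'$. Write $g\le g'$ if some $s\in B^\#$ satisfies $s\cdot g(a)\subseteq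 g'(a)$ for all $a$, and $g\simeq g'$ if $g\le g'$ and $g'\le g$. Identities are $a\mapsto{\downarrow}\{a\}$, composition is $(hg)(a)=\bigcup_{b\in g(a)}h(b)$, and $j\dashv k$ means $\mathrm{id}\le kj$ and $jk\le\mathrm{id}$. An element $s\in B$ *represents* $\alpha\in\mathcal BA$ w.r.t. $g$ if $s\cdot g(a)\subseteq g(\alpha(a))$ for all $a\in\operatorname{dom}\alpha$; $\alpha$ is *effectively representable w.r.t.* $g$ if some $s\in B^\#$ represents it. Let $\iota_f\colon A\to A[f]$, $\iota_f(a)={\downarrow}\{a\}$. **Theorem.** Let $A$ be a PCA that is not semitrivial and let $f\in\mathcal BA$. Then $$\{\alpha\in\mathcal BA\mid\alpha\text{ is effectively representable w.r.t. }\iota_f\colon A\to A[f]\}=\langle(\mathcal BA)^\#\cup\{f\}\rangle,$$ where the filter is generated in $\mathcal BA$. Moreover, the maps $$j(a)={\downarrow}\{\hat a\},\qquad k(\alpha)=\{b\in A\mid b\text{ represents }\alpha\text{ w.r.t. }\iota_f\}$$ are partial applicative morphisms $j\colon A[f]\rightharpoonup\mathcal BA[f]$ and $k\colon\mathcal BA[f]\rightharpoonup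 A[f]$ with $j\dashv k$ and $kj\simeq\mathrm{id}_{A[f]}$. -/

import Mathlib

/-! Relative ordered partial combinatory algebras, oracle computation, and the
algebra of order-compatible partial functions. Possibly undefined expressions are
elements of `Part`. -/

universe u v

/-- `e' ≼ e`: if `e` is defined, then so is `e'`, and `e' ≤ e`. -/
def KleeneLe {A : Type u} [LE A] (e' e : Part A) : Prop :=
  ∀ x ∈ e, ∃ y ∈ e', y ≤ x

/-- `e ≤ x`, including the claim that `e` is defined. -/
def DefinedLe {A : Type u} [LE A] (e : Part A) (x : A) : Prop :=
  ∃ y ∈ e, y ≤ x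

/-- A partial applicative poset on the poset `A`. -/
structure PAP (A : Type u) [PartialOrder A] where
  app : A → A → Part A
  app_mono : ∀ {a' a b' b : A}, a' ≤ a → b' ≤ b → KleeneLe (app a' b') (app a b)

namespace PAP

variable {A : Type u} [PartialOrder A]

/-- Application of possibly undefined expressions. -/
def mul (P : PAP A) (e e' : Part A) : Part A :=
  e.bind fun x => e'.bind fun y => P.app x y

/-- Filters: non-empty, closed under defined application, and upwards closed. -/
structure IsFilter (P : PAP A) (F : Set A) : Prop where
  nonempty : F.Nonempty
  app_mem : ∀ {a b c : A}, a ∈ F → b ∈ F → c ∈ P.app a b → c ∈ F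
  mem_of_le : ∀ {a b : A}, a ≤ b → a ∈ F → b ∈ F

/-- The smallest filter containing a (non-empty) set `X`. -/
def generate (P : PAP A) (X : Set A) : Set A :=
  ⋂₀ {F | P.IsFilter F ∧ X ⊆ F}

theorem subset_generate (P : PAP A) (X : Set A) : X ⊆ P.generate X :=
  fun _ hx _ hF => hF.2 hx

theorem isFilter_generate (P : PAP A) {X : Set A} (hX : X.Nonempty) :
    P.IsFilter (P.generate X) where
  nonempty := hX.mono (P.subset_generate X)
  app_mem := fun ha hb hc F hF => hF.1.app_mem (ha F hF) (hb F hF) hc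
  mem_of_le := fun hab ha F hF => hF.1.mem_of_le hab (ha F hF)

/-- Application of downsets: `α β` is defined iff `a b` is defined for all `a ∈ α` and
`b ∈ β`, and it is then the downward closure of the set of all these `a b`. -/
def downApp (P : PAP A) (α β : LowerSet A) : Part (LowerSet A) where
  Dom := ∀ a ∈ α, ∀ b ∈ β, (P.app a b).Dom
  get _ := lowerClosure {c | ∃ a ∈ α, ∃ b ∈ β, c ∈ P.app a b}

theorem downApp_mono (P : PAP A) {α' α β : LowerSet A} (h : α' ≤ α) :
    KleeneLe (P.downApp α' β) (P.downApp α β) := by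
  rintro _ ⟨hd, rfl⟩
  refine ⟨_, ⟨fun a ha b hb => hd a (h ha) b hb, rfl⟩, ?_⟩
  refine lowerClosure_mono ?_
  rintro c ⟨a, ha, b, hb, hc⟩
  exact ⟨a, h ha, b, hb, hc⟩

end PAP

/-- A partial applicative structure: a partial applicative poset with a filter `A^#`. -/
structure PAS (A : Type u) [PartialOrder A] extends PAP A where
  sharp : Set A
  isFilter_sharp : toPAP.IsFilter sharp

/-- A partial combinatory algebra, with a choice of the combinators `k` and `s`. -/
structure PCA (A : Type u) [PartialOrder A] extends PAS A where
  k : A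
  s : A
  k_mem : k ∈ sharp
  s_mem : s ∈ sharp
  k_le : ∀ a b : A, DefinedLe (toPAP.mul (toPAP.app k a) (Part.some b)) a
  s_dom : ∀ a b : A, (toPAP.mul (toPAP.app s a) (Part.some b)).Dom
  s_le : ∀ a b c : A,
    KleeneLe (toPAP.mul (toPAP.mul (toPAP.app s a) (Part.some b)) (Part.some c))
      (toPAP.mul (toPAP.app a c) (toPAP.app b c))

/-! ### Partial applicative morphisms -/

namespace PAS

variable {A : Type u} {B : Type v} [PartialOrder A] [PartialOrder B]

/-- `g : A → DB` is a partial applicative morphism. -/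
structure IsMorphism (P : PAS A) (Q : PAS B) (g : A → LowerSet B) : Prop where
  sharp : ∀ a ∈ P.sharp, ∃ b ∈ g a, b ∈ Q.sharp
  tracker : ∃ t ∈ Q.sharp, ∀ a a' : A, ∀ c ∈ P.app a a',
    DefinedLe ((Q.downApp (LowerSet.Iic t) (g a)).bind fun γ => Q.downApp γ (g a')) (g c)
  order : ∃ w ∈ Q.sharp, ∀ a : A, (Q.downApp (LowerSet.Iic w) (g a)).Dom ∧
    ∀ a' : A, a ≤ a' → DefinedLe (Q.downApp (LowerSet.Iic w) (g a)) (g a')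

/-- The preorder `g ≤ g'` on functions `A → DB`: some `s ∈ B^#` realizes it. -/
def RealizedLe (Q : PAS B) (g g' : A → LowerSet B) : Prop :=
  ∃ s ∈ Q.sharp, ∀ a : A, DefinedLe (Q.downApp (LowerSet.Iic s) (g a)) (g' a)

/-- `g ≃ g'`. -/
def Equivalent (Q : PAS B) (g g' : A → LowerSet B) : Prop :=
  Q.RealizedLe g g' ∧ Q.RealizedLe g' g

end PAS

/-- The map `a ↦ ↓{a}`; it is the identity morphism of every algebra on `A`. -/
def principal {A : Type u} [PartialOrder A] (a : A) : LowerSet A := LowerSet.Iic a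

/-- The composition `(g h)(a) = ⋃_{b ∈ h(a)} g(b)`. -/
def compMorphism {A B C : Type*} [PartialOrder A] [PartialOrder B] [PartialOrder C]
    (g : B → LowerSet C) (h : A → LowerSet B) (a : A) : LowerSet C :=
  ⨆ b ∈ h a, g b

/-- `j : A ⇀ B` is left adjoint to `k : B ⇀ A`: both are partial applicative morphisms,
`id ≤ k j` and `j k ≤ id`. -/
structure IsAdjunction {A B : Type*} [PartialOrder A] [PartialOrder B] (P : PAS A) (Q : PAS B)
    (j : A → LowerSet B) (k : B → LowerSet A) : Prop where
  left : P.IsMorphism Q j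
  right : Q.IsMorphism P k
  unit : P.RealizedLe principal (compMorphism k j)
  counit : Q.RealizedLe (compMorphism j k) principal

/-! ### The poset of order-compatible partial functions -/

/-- The set `𝓑A` of partial functions `α` on `A` such that `a ≤ b` implies `α a ≼ α b`. -/
structure MonoPFun (A : Type u) [PartialOrder A] where
  toFun : A → Part A
  mono : ∀ {a b : A}, a ≤ b → KleeneLe (toFun a) (toFun b)

namespace MonoPFun

variable {A : Type u} [PartialOrder A]

/-- `α ≤ β` iff `α a ≼ β a` for all `a`. -/
instance : PartialOrder (MonoPFun A) where
  le α β := ∀ a, KleeneLe (α.toFun a) (β.toFun a)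
  le_refl _ _ x hx := ⟨x, hx, le_rfl⟩
  le_trans α β γ h h' a x hx := by
    obtain ⟨y, hy, hyx⟩ := h' a x hx
    obtain ⟨z, hz, hzy⟩ := h a y hy
    exact ⟨z, hz, hzy.trans hyx⟩
  le_antisymm α β h h' := by
    have key : ∀ {e e' : Part A}, KleeneLe e e' → KleeneLe e' e → ∀ x ∈ e, x ∈ e' := by
      intro e e' h1 h2 x hx
      obtain ⟨y, hy, hyx⟩ := h2 x hx
      obtain ⟨z, hz, hzy⟩ := h1 y hy
      obtain rfl := Part.mem_unique hz hx
      rwa [le_antisymm hzy hyx]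
    cases α with
    | mk f hf =>
      cases β with
      | mk g hg =>
        congr
        funext a
        exact Part.ext fun x => ⟨key (h a) (h' a) x, key (h' a) (h a) x⟩

/-- The constant function with value `a`. -/
def const (a : A) : MonoPFun A where
  toFun _ := Part.some a
  mono _ x hx := ⟨x, hx, le_rfl⟩

end MonoPFun

/-! ### Effective representability -/

section Representable

variable {A : Type u} {B : Type v} [PartialOrder A] [PartialOrder B]

/-- `r` represents `α` in `A`: `r a ≼ α a` for all `a`. -/
def PAP.Represents (P : PAP A) (r : A) (α : MonoPFun A) : Prop :=
  ∀ a, KleeneLe (P.app r a) (α.toFun a)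

def PAS.EffectivelyRepresentable (P : PAS A) (α : MonoPFun A) : Prop :=
  ∃ r ∈ P.sharp, P.Represents r α

/-- `s ∈ B` represents `α` w.r.t. `g : A ⇀ B`: for all `a ∈ dom α`, the downset `s · g(a)` is
defined and contained in `g(α(a))`. -/
def PAP.RepresentsVia (Q : PAP B) (g : A → LowerSet B) (s : B) (α : MonoPFun A) : Prop :=
  ∀ a, ∀ c ∈ α.toFun a, DefinedLe (Q.downApp (LowerSet.Iic s) (g a)) (g c)

def PAS.EffectivelyRepresentableVia (Q : PAS B) (g : A → LowerSet B) (α : MonoPFun A) : Prop :=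
  ∃ s ∈ Q.sharp, Q.RepresentsVia g s α

/-- The downset of all representers of `α` w.r.t. `g`. -/
def PAP.representers (Q : PAP B) (g : A → LowerSet B) (α : MonoPFun A) : LowerSet B where
  carrier := {s | Q.RepresentsVia g s α}
  lower' := by
    intro s s' hs h a c hc
    obtain ⟨γ, hγ, hle⟩ := h a c hc
    obtain ⟨δ, hδ, hδγ⟩ := Q.downApp_mono (LowerSet.Iic_le.2 hs) γ hγ
    exact ⟨δ, hδ, hδγ.trans hle⟩

end Representable

/-! ### Terms, bracket abstraction, and coding of sequences -/

/-- Terms over `A` with variables among `x_0, …, x_{n-1}`. -/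
inductive PTerm (A : Type u) : ℕ → Type u
  | var {n : ℕ} (i : Fin n) : PTerm A n
  | const {n : ℕ} (a : A) : PTerm A n
  | app {n : ℕ} (t₀ t₁ : PTerm A n) : PTerm A n

namespace PCA

variable {A : Type u} [PartialOrder A] (P : PCA A)

/-- The interpretation of a term. -/
def eval {n : ℕ} : PTerm A n → (Fin n → A) → Part A
  | .var i, e => Part.some (e i)
  | .const a, _ => Part.some a
  | .app t₀ t₁, e => P.mul (eval t₀ e) (eval t₁ e)

/-- The combinator `i = s k k`. -/
def i : A := (P.mul (P.app P.s P.k) (Part.some P.k)).get (P.s_dom P.k P.k)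

theorem app_k_dom (a : A) : (P.app P.k a).Dom := by
  obtain ⟨y, hy, -⟩ := P.k_le a a
  obtain ⟨x, hx, -⟩ := Part.mem_bind_iff.1 hy
  exact Part.dom_iff_mem.2 ⟨x, hx⟩

/-- The combinator `k̄ = k i`. -/
def kbar : A := (P.app P.k P.i).get (P.app_k_dom P.i)

/-- Bracket abstraction `λ* y. t` of the last variable of a term. -/
def lam {n : ℕ} : PTerm A (n + 1) → PTerm A n
  | .var i => Fin.lastCases (motive := fun _ => PTerm A n) (.const P.i)
      (fun j => .app (.const P.k) (.var j)) i
  | .const a => .app (.const P.k) (.const a)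
  | .app t₀ t₁ => .app (.app (.const P.s) (lam t₀)) (lam t₁)

theorem mul_some (a b : A) : P.mul (Part.some a) (Part.some b) = P.app a b := by
  simp [PAP.mul]

theorem mem_mul {e e' : Part A} {c : A} :
    c ∈ P.mul e e' ↔ ∃ x ∈ e, ∃ y ∈ e', c ∈ P.app x y := by
  simp [PAP.mul, Part.mem_bind_iff]

theorem mul_mono {d d' e e' : Part A} (h : KleeneLe d' d) (h' : KleeneLe e' e) :
    KleeneLe (P.mul d' e') (P.mul d e) := by
  intro z hz
  obtain ⟨x, hx, y, hy, hz⟩ := P.mem_mul.1 hz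
  obtain ⟨x', hx', hxx⟩ := h x hx
  obtain ⟨y', hy', hyy⟩ := h' y hy
  obtain ⟨z', hz', hzz⟩ := P.app_mono hxx hyy z hz
  exact ⟨z', P.mem_mul.2 ⟨x', hx', y', hy', hz'⟩, hzz⟩

theorem eval_lam_dom {n : ℕ} (t : PTerm A (n + 1)) (e : Fin n → A) :
    (P.eval (P.lam t) e).Dom := by
  match t with
  | .var i =>
    induction i using Fin.lastCases with
    | last => simp [lam, eval]
    | cast j => simpa [lam, eval, P.mul_some] using P.app_k_dom (e j)
  | .const a => simpa [lam, eval, P.mul_some] using P.app_k_dom a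
  | .app t₀ t₁ =>
    obtain ⟨x, hx⟩ := Part.dom_iff_mem.1 (eval_lam_dom t₀ e)
    obtain ⟨y, hy⟩ := Part.dom_iff_mem.1 (eval_lam_dom t₁ e)
    have := P.s_dom x y
    rw [lam, eval, eval, Part.eq_some_iff.2 hx, Part.eq_some_iff.2 hy, eval, P.mul_some]
    exact this

theorem eval_lam_beta {n : ℕ} (t : PTerm A (n + 1)) (e : Fin n → A) (a : A) :
    KleeneLe (P.mul (P.eval (P.lam t) e) (Part.some a)) (P.eval t (Fin.snoc e a)) := by
  have hk : ∀ b : A, DefinedLe (P.mul (P.app P.k b) (Part.some a)) b := fun b => P.k_le b a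
  match t with
  | .var i =>
    induction i using Fin.lastCases with
    | last =>
      intro x hx
      simp only [eval, Fin.snoc_last, Part.mem_some_iff] at hx
      subst hx
      obtain ⟨w, hw, hle⟩ := P.k_le x x
      obtain ⟨b, hb⟩ := Part.dom_iff_mem.1 (P.app_k_dom x)
      obtain ⟨w, hw, hle⟩ := P.k_le x b
      obtain ⟨c, hc⟩ : ∃ c, c ∈ P.mul (P.app P.k x) (P.app P.k x) :=
        ⟨w, by rwa [Part.eq_some_iff.2 hb] at hw ⊢⟩
      have hcx : c ≤ x := by
        rw [Part.eq_some_iff.2 hb] at hc hw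
        exact (Part.mem_unique hc hw) ▸ hle
      obtain ⟨y, hy, hyc⟩ := P.s_le P.k P.k x c hc
      refine ⟨y, ?_, hyc.trans hcx⟩
      have hi : P.mul (P.app P.s P.k) (Part.some P.k) = Part.some P.i :=
        (Part.some_get _).symm
      rw [hi] at hy
      simpa [lam, eval] using hy
    | cast j =>
      intro x hx
      simp only [eval, Fin.snoc_castSucc, Part.mem_some_iff] at hx
      subst hx
      simpa [lam, eval, P.mul_some, DefinedLe] using hk (e j)
  | .const b =>
    intro x hx
    simp only [eval, Part.mem_some_iff] at hx
    subst hx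
    simpa [lam, eval, P.mul_some, DefinedLe] using hk x
  | .app t₀ t₁ =>
    obtain ⟨x, hx⟩ := Part.dom_iff_mem.1 (P.eval_lam_dom t₀ e)
    obtain ⟨y, hy⟩ := Part.dom_iff_mem.1 (P.eval_lam_dom t₁ e)
    have h0 := eval_lam_beta t₀ e a
    have h1 := eval_lam_beta t₁ e a
    rw [Part.eq_some_iff.2 hx, P.mul_some] at h0
    rw [Part.eq_some_iff.2 hy, P.mul_some] at h1
    intro z hz
    obtain ⟨z', hz', hzz⟩ := P.mul_mono h0 h1 z hz
    obtain ⟨z'', hz'', hzz'⟩ := P.s_le x y a z' hz'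
    refine ⟨z'', ?_, hzz'.trans hzz⟩
    rw [lam, eval, eval, Part.eq_some_iff.2 hx, Part.eq_some_iff.2 hy, eval, P.mul_some]
    exact hz''

/-- The element of `A` given by the closed term `λ* x. t`. -/
def abs (t : PTerm A 1) : A := (P.eval (P.lam t) Fin.elim0).get (P.eval_lam_dom t Fin.elim0)

/-- The pairing combinator `p = λ* x y z. z x y`. -/
def p : A := P.abs (P.lam (P.lam (.app (.app (.var 2) (.var 0)) (.var 1))))

/-- The unpairing combinator `p₀ = λ* x. x k`. -/
def p₀ : A := P.abs (.app (.var 0) (.const P.k))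

/-- The unpairing combinator `p₁ = λ* x. x k̄`. -/
def p₁ : A := P.abs (.app (.var 0) (.const P.kbar))

/-- The boolean `⊤ = k`. -/
def tt : A := P.k

/-- The boolean `⊥ = k̄`. -/
def ff : A := P.kbar

/-- The booleans have a common lower bound. -/
def Semitrivial : Prop := ∃ w : A, w ≤ P.tt ∧ w ≤ P.ff

theorem pair_dom (a b : A) : (P.mul (P.app P.p a) (Part.some b)).Dom := by
  set t : PTerm A 3 := .app (.app (.var 2) (.var 0)) (.var 1) with ht
  have hp : Part.some P.p = P.eval (P.lam (P.lam (P.lam t))) Fin.elim0 := Part.some_get _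
  have h1 := P.eval_lam_beta (P.lam (P.lam t)) Fin.elim0 a
  rw [← hp, P.mul_some] at h1
  have h2 := P.mul_mono h1 (e' := Part.some b) (e := Part.some b)
    (fun x hx => ⟨x, hx, le_rfl⟩)
  have h3 := P.eval_lam_beta (P.lam t) (Fin.snoc Fin.elim0 a) b
  obtain ⟨x, hx⟩ := Part.dom_iff_mem.1
    (P.eval_lam_dom t (Fin.snoc (Fin.snoc Fin.elim0 a : Fin 1 → A) b))
  obtain ⟨y, hy, -⟩ := h3 x hx
  obtain ⟨z, hz, -⟩ := h2 y hy
  exact Part.dom_iff_mem.2 ⟨z, hz⟩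

/-- The pair `p a b`. -/
def pair (a b : A) : A := (P.mul (P.app P.p a) (Part.some b)).get (P.pair_dom a b)

theorem pair_mono {a' a b' b : A} (ha : a' ≤ a) (hb : b' ≤ b) : P.pair a' b' ≤ P.pair a b := by
  have hb' : KleeneLe (Part.some b') (Part.some b) := by
    intro x hx
    rw [Part.mem_some_iff] at hx
    exact ⟨b', Part.mem_some _, hx ▸ hb⟩
  obtain ⟨y, hy, hle⟩ := P.mul_mono (P.app_mono (le_refl P.p) ha) hb' (P.pair a b)
    (Part.get_mem _)
  rwa [Part.mem_unique hy (Part.get_mem (P.pair_dom a' b'))] at hle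

/-- Numerals: `0 = i` and `n + 1 = p ⊥ n`. -/
def numeral : ℕ → A
  | 0 => P.i
  | n + 1 => P.pair P.ff (numeral n)

/-- Tuples: `j⁰() = i` and `jⁿ⁺¹(a₀, …, aₙ) = p a₀ (jⁿ(a₁, …, aₙ))`. -/
def tuple : List A → A
  | [] => P.i
  | a :: l => P.pair a (tuple l)

/-- The code `[a₀, …, a_{n-1}] = p n (jⁿ(a₀, …, a_{n-1}))` of a finite sequence. -/
def code (l : List A) : A := P.pair (P.numeral l.length) (P.tuple l)

theorem tuple_mono {l' l : List A} (h : List.Forall₂ (· ≤ ·) l' l) : P.tuple l' ≤ P.tuple l := by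
  induction h with
  | nil => exact le_rfl
  | cons h _ ih => exact P.pair_mono h ih

theorem code_mono {l' l : List A} (h : List.Forall₂ (· ≤ ·) l' l) : P.code l' ≤ P.code l := by
  unfold code
  rw [h.length_eq]
  exact P.pair_mono le_rfl (P.tuple_mono h)

/-! ### Oracle computation -/

/-- The sequence `u = (u₀, …, u_{n-1})` consists of successive answers of the oracle `f` to
the interrogator `q` on input `b`: for all `m < n`, we have `p₀ (q [b, u₀, …, u_{m-1}]) ≤ ⊥` and
`f (p₁ (q [b, u₀, …, u_{m-1}])) = u_m`. -/
def IsInterrogation (q f : A → Part A) (b : A) (u : List A) : Prop :=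
  ∀ (m : ℕ) (hm : m < u.length),
    DefinedLe ((q (P.code (b :: u.take m))).bind (P.app P.p₀)) P.ff ∧
    u[m] ∈ ((q (P.code (b :: u.take m))).bind (P.app P.p₁)).bind f

/-- Some interrogation `u` ends with output `c`: `p₀ (q [b, u₀, …, u_{n-1}]) ≤ ⊤` and
`p₁ (q [b, u₀, …, u_{n-1}]) = c`. -/
def Computes (q f : A → Part A) (b c : A) : Prop :=
  ∃ u : List A, P.IsInterrogation q f b u ∧
    DefinedLe ((q (P.code (b :: u))).bind (P.app P.p₀)) P.tt ∧
    c ∈ (q (P.code (b :: u))).bind (P.app P.p₁)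

/-- The result, if any, of interrogating `f` by `q` on input `b`. -/
noncomputable def oracleApp (q f : A → Part A) (b : A) : Part A where
  Dom := ∃ c, P.Computes q f b c
  get h := h.choose

theorem computes_unique (hP : ¬ P.Semitrivial) {q f : A → Part A} {b c d : A}
    (hc : P.Computes q f b c) (hd : P.Computes q f b d) : c = d := by
  obtain ⟨u, hu, hut, huc⟩ := hc
  obtain ⟨v, hv, hvt, hvd⟩ := hd
  have key : ∀ m, m ≤ u.length → m ≤ v.length → u.take m = v.take m := by
    intro m
    induction m with
    | zero => simp
    | succ m ih =>
      intro h1 h2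
      have ih' := ih (by omega) (by omega)
      have e1 := (hu m (by omega)).2
      have e2 := (hv m (by omega)).2
      rw [ih'] at e1
      rw [List.take_succ_eq_append_getElem (by omega), List.take_succ_eq_append_getElem (by omega),
        ih', Part.mem_unique e1 e2]
  have contra : ∀ {x : Part A}, DefinedLe x P.tt → DefinedLe x P.ff → False := by
    rintro x ⟨y, hy, hyt⟩ ⟨z, hz, hzf⟩
    obtain rfl := Part.mem_unique hy hz
    exact hP ⟨y, hyt, hzf⟩
  have huv : u = v := by
    rcases lt_trichotomy u.length v.length with h | h | h
    · exfalso
      have e := key u.length le_rfl h.le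
      rw [List.take_length] at e
      exact contra (e ▸ hut) (hv _ h).1
    · have e := key u.length le_rfl h.le
      rwa [List.take_length, h, List.take_length] at e
    · exfalso
      have e := key v.length h.le le_rfl
      rw [List.take_length] at e
      exact contra (e.symm ▸ hvt) (hu _ h).1
  subst huv
  exact Part.mem_unique huc hvd

theorem mem_oracleApp (hP : ¬ P.Semitrivial) {q f : A → Part A} {b c : A} :
    c ∈ P.oracleApp q f b ↔ P.Computes q f b c := by
  constructor
  · rintro ⟨h, rfl⟩
    exact h.choose_spec
  · intro h
    have hdom : ∃ c, P.Computes q f b c := ⟨c, h⟩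
    exact ⟨hdom, P.computes_unique hP hdom.choose_spec h⟩

theorem oracleApp_mono (hP : ¬ P.Semitrivial) {q' q f' f : A → Part A} {b' b : A}
    (hq : ∀ {x' x : A}, x' ≤ x → KleeneLe (q' x') (q x))
    (hf : ∀ {x' x : A}, x' ≤ x → KleeneLe (f' x') (f x)) (hb : b' ≤ b) :
    KleeneLe (P.oracleApp q' f' b') (P.oracleApp q f b) := by
  intro c hc
  obtain ⟨u, hu, hut, huc⟩ := (P.mem_oracleApp hP).1 hc
  have step : ∀ {l' l : List A} (r : A), List.Forall₂ (· ≤ ·) l' l →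
      KleeneLe ((q' (P.code (b' :: l'))).bind (P.app r)) ((q (P.code (b :: l))).bind (P.app r)) := by
    intro l' l r h x hx
    obtain ⟨y, hy, hx⟩ := Part.mem_bind_iff.1 hx
    obtain ⟨y', hy', hyy⟩ := hq (P.code_mono (List.Forall₂.cons hb h)) y hy
    obtain ⟨x', hx', hxx⟩ := P.app_mono (le_refl r) hyy x hx
    exact ⟨x', Part.mem_bind_iff.2 ⟨y', hy', hx'⟩, hxx⟩
  have trans : ∀ {x' x : Part A} {y : A}, KleeneLe x' x → DefinedLe x y → DefinedLe x' y := by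
    rintro x' x y h ⟨z, hz, hzy⟩
    obtain ⟨w, hw, hwz⟩ := h z hz
    exact ⟨w, hw, hwz.trans hzy⟩
  have key : ∀ m, m ≤ u.length → ∃ v : List A, List.Forall₂ (· ≤ ·) v (u.take m) ∧
      P.IsInterrogation q' f' b' v := by
    intro m
    induction m with
    | zero => exact fun _ => ⟨[], by simp, fun m hm => absurd hm (by simp)⟩
    | succ m ih =>
      intro hm
      obtain ⟨v, hv, hvi⟩ := ih (by omega)
      have hlen : v.length = m := by
        rw [hv.length_eq, List.length_take]; omega
      obtain ⟨hbot, hans⟩ := hu m (by omega)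
      obtain ⟨x, hx, hfx⟩ := Part.mem_bind_iff.1 hans
      obtain ⟨x', hx', hxx⟩ := step P.p₁ hv x hx
      obtain ⟨w, hw, hwu⟩ := hf hxx _ hfx
      refine ⟨v ++ [w], ?_, ?_⟩
      · rw [List.take_succ_eq_append_getElem (by omega)]
        exact List.rel_append hv (List.Forall₂.cons hwu List.Forall₂.nil)
      · intro k hk
        rw [List.length_append, List.length_singleton] at hk
        rcases Nat.lt_or_ge k v.length with h | h
        · rw [List.take_append_of_le_length h.le, List.getElem_append_left h]
          exact hvi k h
        · obtain rfl : k = v.length := by omega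
          rw [List.take_left' rfl, List.getElem_concat_length rfl]
          exact ⟨trans (step P.p₀ hv) hbot, Part.mem_bind_iff.2 ⟨x', hx', hw⟩⟩
  obtain ⟨v, hv, hvi⟩ := key u.length le_rfl
  rw [List.take_length] at hv
  obtain ⟨c', hc', hcc⟩ := step P.p₁ hv c huc
  exact ⟨c', (P.mem_oracleApp hP).2 ⟨v, hvi, trans (step P.p₀ hv) hut, hc'⟩, hcc⟩

/-- The algebra `A[f]`: the interrogator in `a ⊙ b` is `a`, the input is `b` and the oracle is `f`.
Its filter is the one generated by `A^#` with respect to `⊙`. -/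
noncomputable def adjoinFun (hP : ¬ P.Semitrivial) (f : MonoPFun A) : PAS A :=
  let Q : PAP A :=
    { app := fun a b => P.oracleApp (P.app a) f.toFun b
      app_mono := fun ha hb => P.oracleApp_mono hP (fun hx => P.app_mono ha hx) f.mono hb }
  { toPAP := Q
    sharp := Q.generate P.sharp
    isFilter_sharp := Q.isFilter_generate ⟨P.k, P.k_mem⟩ }

/-- The order and the (total) application on `𝓑A`: the interrogator in `αβ(a)` is `α`, the input
is `a` and the oracle is `β`. -/
noncomputable def funPAP (hP : ¬ P.Semitrivial) : PAP (MonoPFun A) where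
  app α β := Part.some
    { toFun := P.oracleApp α.toFun β.toFun
      mono := fun hab => P.oracleApp_mono hP α.mono β.mono hab }
  app_mono := by
    intro α' α β' β hα hβ γ hγ
    rw [Part.mem_some_iff] at hγ
    subst hγ
    have aux : ∀ {δ' δ : MonoPFun A}, δ' ≤ δ → ∀ {x' x : A}, x' ≤ x →
        KleeneLe (δ'.toFun x') (δ.toFun x) := by
      intro δ' δ h x' x hx y hy
      obtain ⟨z, hz, hzy⟩ := δ.mono hx y hy
      obtain ⟨w, hw, hwz⟩ := h x' z hz
      exact ⟨w, hw, hwz.trans hzy⟩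
    exact ⟨_, Part.mem_some _, fun a => P.oracleApp_mono hP (aux hα) (aux hβ) le_rfl⟩

/-- The set `(𝓑A)^#` of effectively representable functions. -/
def funSharp : Set (MonoPFun A) := {α | P.EffectivelyRepresentable α}

/-- The algebra `𝓑A[f]`, in which `f` is adjoined as an element: it is `𝓑A` with the filter
generated by `(𝓑A)^#` and `f`. -/
noncomputable def funAdjoinElem (hP : ¬ P.Semitrivial) (f : MonoPFun A) : PAS (MonoPFun A) where
  toPAP := P.funPAP hP
  sharp := (P.funPAP hP).generate (P.funSharp ∪ {f})
  isFilter_sharp := (P.funPAP hP).isFilter_generate ⟨f, Or.inr rfl⟩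

end PCA

/-! Exact answers of an oracle are awkward in an ordered algebra. They are replaced by the inductive
relation `Dialogue`, which knows every move, question and answer only up to ≤. Since interrogator
and oracle are monotone, a dialogue with result c exists exactly when the oracle application is
defined and at most c (`definedLe_oracleApp_iff`); non-semitriviality enters only through the
determinism of the application. Every claim then reduces to exhibiting an interrogator in A^# and
its dialogues.

The functions effectively representable w.r.t. ι_f form a filter of 𝓑A. It contains (𝓑A)^# (`liftQ`
asks nothing) and f (`copyQ` asks one question). The hard point is closure under application: from
representers s of α and t of β one needs, uniformly, a representer of αβ. It runs s against f to
find the next move of α, runs t against f whenever that move is a question to β, and iterates.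
Interrogators keep no state, so each call replays the whole simulation from the answers received so
far. This takes a fixed point combinator and continuations (`runE_app`, `simE_app`) and is packaged
in `compQ_adjoinFun`.

Conversely, f yields an element of 𝓑A[f]^# that sends p a b below a ⊙ b (`evalFun`). From it come
`appFun`, which applies constant functions to each other, and `counitFun`, which turns the constant
b̂ into a function below any function that b represents. By the former, the a with â in the filter
form a filter for ⊙ containing A^#, hence containing A[f]^#. So if s ∈ A[f]^# represents α, then ŝ
is in the filter and so is α, being above `counitFun` applied to ŝ.

The same elements realize the adjunction: `appFun` and `compQ` track j and k, `constQ` gives the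
unit and `counitFun` the counit. Finally kj ≤ id because a representer of a function below â can be
evaluated at i (`forceQ`). -/

section Defined

variable {A : Type u} [PartialOrder A]

theorem DefinedLe.of_kleeneLe {e' e : Part A} {x : A} (h : DefinedLe e x) (he : KleeneLe e' e) :
    DefinedLe e' x := by
  obtain ⟨y, hy, hyx⟩ := h
  obtain ⟨z, hz, hzy⟩ := he y hy
  exact ⟨z, hz, hzy.trans hyx⟩

theorem DefinedLe.mono {e : Part A} {x y : A} (h : DefinedLe e x) (hxy : x ≤ y) :
    DefinedLe e y := by
  obtain ⟨z, hz, hzx⟩ := h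
  exact ⟨z, hz, hzx.trans hxy⟩

theorem definedLe_some {x y : A} : DefinedLe (Part.some x) y ↔ x ≤ y := by
  simp [DefinedLe]

theorem DefinedLe.of_mem {e : Part A} {x : A} (h : x ∈ e) : DefinedLe e x := ⟨x, h, le_rfl⟩

theorem KleeneLe.refl (e : Part A) : KleeneLe e e := fun x hx => ⟨x, hx, le_rfl⟩

theorem PAP.definedLe_app (P : PAP A) {x x' y y' c : A} (h : DefinedLe (P.app x y) c)
    (hx : x' ≤ x) (hy : y' ≤ y) : DefinedLe (P.app x' y') c :=
  h.of_kleeneLe (P.app_mono hx hy)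

/-- Monotonicity turns a defined product of upper bounds into a defined product of the values, so
computations need to carry bounds only. -/
theorem PAP.definedLe_mul (P : PAP A) {e e' : Part A} {x y c : A} (hx : DefinedLe e x)
    (hy : DefinedLe e' y) (h : DefinedLe (P.app x y) c) : DefinedLe (P.mul e e') c := by
  obtain ⟨x', hx', hxx⟩ := hx
  obtain ⟨y', hy', hyy⟩ := hy
  obtain ⟨c', hc', hcc⟩ := P.definedLe_app h hxx hyy
  exact ⟨c', Part.mem_bind_iff.2 ⟨x', hx', Part.mem_bind_iff.2 ⟨y', hy', hc'⟩⟩, hcc⟩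

/-- Iterated application `a b c` with a value as an upper bound. -/
theorem PAP.definedLe_mul_some (P : PAP A) {e : Part A} {x y c : A} (hx : DefinedLe e x)
    (h : DefinedLe (P.app x y) c) : DefinedLe (P.mul e (Part.some y)) c :=
  P.definedLe_mul hx (definedLe_some.2 le_rfl) h

theorem DefinedLe.bind_app {P : PAP A} {e : Part A} {r x c : A} (h : DefinedLe e x)
    (hx : DefinedLe (P.app r x) c) : DefinedLe (e.bind (P.app r)) c := by
  obtain ⟨x', hx', hxx⟩ := h
  obtain ⟨c', hc', hcc⟩ := P.definedLe_app hx le_rfl hxx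
  exact ⟨c', Part.mem_bind_iff.2 ⟨x', hx', hc'⟩, hcc⟩

end Defined

/-! ### Terms with constants in the filter -/

namespace PTerm

variable {A : Type u}

/-- All constants of the term belong to `S`. -/
inductive ConstsIn (S : Set A) : {n : ℕ} → PTerm A n → Prop
  | var {n : ℕ} (i : Fin n) : ConstsIn S (.var i : PTerm A n)
  | const {n : ℕ} {a : A} (h : a ∈ S) : ConstsIn S (.const a : PTerm A n)
  | app {n : ℕ} {t₀ t₁ : PTerm A n} (h₀ : ConstsIn S t₀) (h₁ : ConstsIn S t₁) :
      ConstsIn S (.app t₀ t₁)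

end PTerm

namespace PCA

variable {A : Type u} [PartialOrder A] (P : PCA A)

theorem i_mem : P.i ∈ P.sharp := by
  obtain ⟨x, hx, y, hy, h⟩ := P.mem_mul.1 (Part.get_mem (P.s_dom P.k P.k))
  rw [Part.mem_some_iff] at hy
  subst hy
  exact P.isFilter_sharp.app_mem (P.isFilter_sharp.app_mem P.s_mem P.k_mem hx) P.k_mem h

theorem tt_mem : P.tt ∈ P.sharp := P.k_mem

theorem ff_mem : P.ff ∈ P.sharp :=
  P.isFilter_sharp.app_mem P.k_mem P.i_mem (Part.get_mem (P.app_k_dom P.i))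

theorem constsIn_lam {n : ℕ} (t : PTerm A (n + 1)) (h : t.ConstsIn P.sharp) :
    (P.lam t).ConstsIn P.sharp := by
  match t with
  | .var i =>
    induction i using Fin.lastCases with
    | last => simpa [lam] using .const P.i_mem
    | cast j => simpa [lam] using .app (.const P.k_mem) (.var j)
  | .const a =>
    cases h with
    | const h => exact .app (.const P.k_mem) (.const h)
  | .app t₀ t₁ =>
    cases h with
    | app h₀ h₁ =>
      exact .app (.app (.const P.s_mem) (constsIn_lam t₀ h₀)) (constsIn_lam t₁ h₁)

theorem eval_mem_sharp (t : PTerm A 0) (h : t.ConstsIn P.sharp) (e : Fin 0 → A) {c : A}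
    (hc : c ∈ P.eval t e) : c ∈ P.sharp := by
  match t with
  | .var i => exact i.elim0
  | .const a =>
    rw [eval, Part.mem_some_iff] at hc
    cases h with
    | const h => exact hc ▸ h
  | .app t₀ t₁ =>
    obtain ⟨x, hx, y, hy, hxy⟩ := P.mem_mul.1 hc
    cases h with
    | app h₀ h₁ =>
      exact P.isFilter_sharp.app_mem (eval_mem_sharp t₀ h₀ e hx) (eval_mem_sharp t₁ h₁ e hy) hxy

theorem abs_mem (t : PTerm A 1) (h : t.ConstsIn P.sharp) : P.abs t ∈ P.sharp :=
  P.eval_mem_sharp _ (P.constsIn_lam t h) Fin.elim0 (Part.get_mem _)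

/-! ### Evaluation of terms -/

section Eval

variable {P} {n : ℕ} {e : Fin n → A}

theorem ev_var {i : Fin n} {x : A} (h : e i ≤ x) : DefinedLe (P.eval (.var i) e) x :=
  definedLe_some.2 h

theorem ev_const {a : A} : DefinedLe (P.eval (.const a) e) a := definedLe_some.2 le_rfl

theorem ev_app {t₀ t₁ : PTerm A n} {x y c : A} (h₀ : DefinedLe (P.eval t₀ e) x)
    (h₁ : DefinedLe (P.eval t₁ e) y) (h : DefinedLe (P.app x y) c) :
    DefinedLe (P.eval (.app t₀ t₁) e) c :=
  P.definedLe_mul h₀ h₁ h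

/-- The value of an abstraction. -/
def lamVal (P : PCA A) (t : PTerm A (n + 1)) (e : Fin n → A) : A :=
  (P.eval (P.lam t) e).get (P.eval_lam_dom t e)

theorem ev_lam {t : PTerm A (n + 1)} : DefinedLe (P.eval (P.lam t) e) (P.lamVal t e) :=
  .of_mem (Part.get_mem _)

theorem lamVal_app {t : PTerm A (n + 1)} {a c : A} (h : DefinedLe (P.eval t (Fin.snoc e a)) c) :
    DefinedLe (P.app (P.lamVal t e) a) c := by
  have := h.of_kleeneLe (P.eval_lam_beta t e a)
  rwa [Part.eq_some_iff.2 (Part.get_mem (P.eval_lam_dom t e)), P.mul_some] at this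

theorem abs_app {t : PTerm A 1} {a c : A} (h : DefinedLe (P.eval t (Fin.snoc Fin.elim0 a)) c) :
    DefinedLe (P.app (P.abs t) a) c :=
  lamVal_app h

/-- The intermediate value is exposed because terms are evaluated below one application at a time.
-/
theorem k_app (a b : A) : ∃ x, DefinedLe (P.app P.k a) x ∧ DefinedLe (P.app x b) a := by
  obtain ⟨y, hy, hya⟩ := P.k_le a b
  obtain ⟨x, hx, z, hz, h⟩ := P.mem_mul.1 hy
  rw [Part.mem_some_iff] at hz
  exact ⟨x, .of_mem hx, y, hz ▸ h, hya⟩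

/-- Bracket abstraction of the last variable itself is `i`, so this is an instance of the β-rule. -/
theorem i_app (a : A) : DefinedLe (P.app P.i a) a := by
  have h := P.eval_lam_beta (.var (Fin.last 0)) Fin.elim0 a
  have h' : DefinedLe (P.eval (.var (Fin.last 0)) (Fin.snoc Fin.elim0 a)) a := ev_var le_rfl
  have h := h'.of_kleeneLe h
  rwa [lam, Fin.lastCases_last, eval, P.mul_some] at h

theorem kbar_app (a b : A) : ∃ x, DefinedLe (P.app P.kbar a) x ∧ DefinedLe (P.app x b) b := by
  obtain ⟨y, hy, hyi⟩ := P.k_le P.i a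
  refine ⟨P.i, ⟨y, ?_, hyi⟩, i_app b⟩
  rwa [Part.eq_some_iff.2 (Part.get_mem (P.app_k_dom P.i)), P.mul_some] at hy

theorem pair_app (a b : A) {z x c : A} (h : DefinedLe (P.app z a) x) (h' : DefinedLe (P.app x b) c) :
    DefinedLe (P.app (P.pair a b) z) c := by
  set t : PTerm A 3 := .app (.app (.var 2) (.var 0)) (.var 1) with ht
  have h1 : DefinedLe (P.app P.p a) (P.lamVal (P.lam t) (Fin.snoc Fin.elim0 a)) := abs_app ev_lam
  have h2 : DefinedLe (P.mul (P.app P.p a) (Part.some b))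
      (P.lamVal t (Fin.snoc (Fin.snoc Fin.elim0 a : Fin 1 → A) b)) :=
    P.definedLe_mul_some h1 (lamVal_app ev_lam)
  obtain ⟨y, hy, hle⟩ := h2
  obtain rfl := Part.mem_unique hy (Part.get_mem (P.pair_dom a b))
  refine P.definedLe_app (lamVal_app ?_) hle le_rfl
  exact ev_app (ev_app (ev_var le_rfl) (ev_var le_rfl) h) (ev_var le_rfl) h'

theorem p₀_pair (a b : A) : DefinedLe (P.app P.p₀ (P.pair a b)) a := by
  obtain ⟨x, hx, hx'⟩ := k_app (P := P) a b
  exact abs_app (ev_app (ev_var le_rfl) ev_const (pair_app a b hx hx'))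

theorem p₁_pair (a b : A) : DefinedLe (P.app P.p₁ (P.pair a b)) b := by
  obtain ⟨x, hx, hx'⟩ := kbar_app (P := P) a b
  exact abs_app (ev_app (ev_var le_rfl) ev_const (pair_app a b hx hx'))

/-- The numeral 0 is `i` and positive numerals are pairs with first component ⊥, so `p₀` serves as
the zero test. -/
theorem p₀_i : DefinedLe (P.app P.p₀ P.i) P.tt :=
  abs_app (ev_app (ev_var le_rfl) ev_const (i_app P.k))

theorem p_mem : P.p ∈ P.sharp :=
  P.abs_mem _ (P.constsIn_lam _ (P.constsIn_lam _ (.app (.app (.var _) (.var _)) (.var _))))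

theorem p₀_mem : P.p₀ ∈ P.sharp := P.abs_mem _ (.app (.var _) (.const P.tt_mem))

theorem p₁_mem : P.p₁ ∈ P.sharp := P.abs_mem _ (.app (.var _) (.const P.ff_mem))

theorem pair_mem {a b : A} (ha : a ∈ P.sharp) (hb : b ∈ P.sharp) : P.pair a b ∈ P.sharp := by
  obtain ⟨x, hx, y, hy, h⟩ := P.mem_mul.1 (Part.get_mem (P.pair_dom a b))
  rw [Part.mem_some_iff] at hy
  subst hy
  exact P.isFilter_sharp.app_mem (P.isFilter_sharp.app_mem p_mem ha hx) hb h

theorem code_nil_mem : P.code [] ∈ P.sharp := pair_mem P.i_mem P.i_mem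

end Eval

/-! ### Derived term formers -/

section Terms

variable {n : ℕ}

def pairT (t u : PTerm A n) : PTerm A n := .app (.app (.const P.p) t) u

def fstT (t : PTerm A n) : PTerm A n := .app (.const P.p₀) t

def sndT (t : PTerm A n) : PTerm A n := .app (.const P.p₁) t

/-- Interrogator output that ends the computation with value `t`. -/
def retT (t : PTerm A n) : PTerm A n := P.pairT (.const P.tt) t

/-- Interrogator output that asks the oracle the question `t`. -/
def askT (t : PTerm A n) : PTerm A n := P.pairT (.const P.ff) t

/-- The truth value of `l = []` for a code of a sequence `l`. -/
def nullT (t : PTerm A n) : PTerm A n := P.fstT (P.fstT t)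

def headT (t : PTerm A n) : PTerm A n := P.fstT (P.sndT t)

-- On the length component `p₁` is the predecessor, since n + 1 is p ⊥ n.
def tailT (t : PTerm A n) : PTerm A n := P.pairT (P.sndT (P.fstT t)) (P.sndT (P.sndT t))

def consT (t u : PTerm A n) : PTerm A n :=
  P.pairT (P.pairT (.const P.ff) (P.fstT u)) (P.pairT t (P.sndT u))

/-- Definition by cases; the branches are only evaluated when they are selected. -/
def iteT (b : PTerm A n) (t u : PTerm A (n + 1)) : PTerm A n :=
  .app (.app (.app b (P.lam t)) (P.lam u)) (.const P.i)

variable {P} {e : Fin n → A} {t u : PTerm A n} {x y : A} {l : List A}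

theorem ev_pair (ht : DefinedLe (P.eval t e) x) (hu : DefinedLe (P.eval u e) y) :
    DefinedLe (P.eval (P.pairT t u) e) (P.pair x y) := by
  obtain ⟨z, hz, w, hw, h⟩ := P.mem_mul.1 (Part.get_mem (P.pair_dom x y))
  rw [Part.mem_some_iff] at hw
  subst hw
  exact ev_app (ev_app ev_const ht (.of_mem hz)) hu (.of_mem h)

theorem ev_fst (h : DefinedLe (P.eval t e) (P.pair x y)) : DefinedLe (P.eval (P.fstT t) e) x :=
  ev_app ev_const h (p₀_pair x y)

theorem ev_snd (h : DefinedLe (P.eval t e) (P.pair x y)) : DefinedLe (P.eval (P.sndT t) e) y :=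
  ev_app ev_const h (p₁_pair x y)

theorem ev_ret (h : DefinedLe (P.eval t e) x) :
    DefinedLe (P.eval (P.retT t) e) (P.pair P.tt x) :=
  ev_pair ev_const h

theorem ev_ask (h : DefinedLe (P.eval t e) x) :
    DefinedLe (P.eval (P.askT t) e) (P.pair P.ff x) :=
  ev_pair ev_const h

theorem ev_null_nil (h : DefinedLe (P.eval t e) (P.code [])) :
    DefinedLe (P.eval (P.nullT t) e) P.tt :=
  ev_app ev_const (ev_fst h) p₀_i

theorem ev_null_cons (h : DefinedLe (P.eval t e) (P.code (x :: l))) :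
    DefinedLe (P.eval (P.nullT t) e) P.ff :=
  ev_fst (ev_fst h)

theorem ev_head (h : DefinedLe (P.eval t e) (P.code (x :: l))) :
    DefinedLe (P.eval (P.headT t) e) x :=
  ev_fst (ev_snd h)

theorem ev_tail (h : DefinedLe (P.eval t e) (P.code (x :: l))) :
    DefinedLe (P.eval (P.tailT t) e) (P.code l) :=
  ev_pair (ev_snd (ev_fst h)) (ev_snd (ev_snd h))

theorem ev_cons (ht : DefinedLe (P.eval t e) x) (hu : DefinedLe (P.eval u e) (P.code l)) :
    DefinedLe (P.eval (P.consT t u) e) (P.code (x :: l)) :=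
  ev_pair (ev_pair ev_const (ev_fst hu)) (ev_pair ht (ev_snd hu))

theorem ev_ite_true {b : PTerm A n} {t u : PTerm A (n + 1)} (hb : DefinedLe (P.eval b e) P.tt)
    (ht : DefinedLe (P.eval t (Fin.snoc e P.i)) x) : DefinedLe (P.eval (P.iteT b t u) e) x := by
  obtain ⟨z, hz, hz'⟩ := k_app (P := P) (P.lamVal t e) (P.lamVal u e)
  exact ev_app (ev_app (ev_app hb ev_lam hz) ev_lam hz') ev_const (lamVal_app ht)

theorem ev_ite_false {b : PTerm A n} {t u : PTerm A (n + 1)} (hb : DefinedLe (P.eval b e) P.ff)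
    (hu : DefinedLe (P.eval u (Fin.snoc e P.i)) x) : DefinedLe (P.eval (P.iteT b t u) e) x := by
  obtain ⟨z, hz, hz'⟩ := kbar_app (P := P) (P.lamVal t e) (P.lamVal u e)
  exact ev_app (ev_app (ev_app hb ev_lam hz) ev_lam hz') ev_const (lamVal_app hu)

theorem constsIn_pairT (ht : t.ConstsIn P.sharp) (hu : u.ConstsIn P.sharp) :
    (P.pairT t u).ConstsIn P.sharp :=
  .app (.app (.const p_mem) ht) hu

theorem constsIn_fstT (ht : t.ConstsIn P.sharp) : (P.fstT t).ConstsIn P.sharp := .app (.const p₀_mem) ht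

theorem constsIn_sndT (ht : t.ConstsIn P.sharp) : (P.sndT t).ConstsIn P.sharp := .app (.const p₁_mem) ht

theorem constsIn_retT (ht : t.ConstsIn P.sharp) : (P.retT t).ConstsIn P.sharp :=
  constsIn_pairT (.const P.tt_mem) ht

theorem constsIn_askT (ht : t.ConstsIn P.sharp) : (P.askT t).ConstsIn P.sharp :=
  constsIn_pairT (.const P.ff_mem) ht

theorem constsIn_nullT (ht : t.ConstsIn P.sharp) : (P.nullT t).ConstsIn P.sharp :=
  constsIn_fstT (constsIn_fstT ht)

theorem constsIn_headT (ht : t.ConstsIn P.sharp) : (P.headT t).ConstsIn P.sharp :=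
  constsIn_fstT (constsIn_sndT ht)

theorem constsIn_tailT (ht : t.ConstsIn P.sharp) : (P.tailT t).ConstsIn P.sharp :=
  constsIn_pairT (constsIn_sndT (constsIn_fstT ht)) (constsIn_sndT (constsIn_sndT ht))

theorem constsIn_consT (ht : t.ConstsIn P.sharp) (hu : u.ConstsIn P.sharp) :
    (P.consT t u).ConstsIn P.sharp :=
  constsIn_pairT (constsIn_pairT (.const P.ff_mem) (constsIn_fstT hu)) (constsIn_pairT ht (constsIn_sndT hu))

theorem constsIn_iteT {b : PTerm A n} {t u : PTerm A (n + 1)} (hb : b.ConstsIn P.sharp)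
    (ht : t.ConstsIn P.sharp) (hu : u.ConstsIn P.sharp) : (P.iteT b t u).ConstsIn P.sharp :=
  .app (.app (.app hb (P.constsIn_lam t ht)) (P.constsIn_lam u hu)) (.const P.i_mem)

end Terms

/-! ### Dialogues -/

/-- A strategy `K` maps the list of the answers received so far to the next move. It reaches the
result `c` in a dialogue with the oracle `f`, up to the order of `A`. -/
inductive Dialogue (f : A → Part A) : (List A → Part A) → A → Prop
  | ret {K : List A → Part A} {r c : A} (hr : DefinedLe (K []) r)
      (h₀ : DefinedLe (P.app P.p₀ r) P.tt) (h₁ : DefinedLe (P.app P.p₁ r) c) : Dialogue f K c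
  | ask {K : List A → Part A} {r x u c : A} (hr : DefinedLe (K []) r)
      (h₀ : DefinedLe (P.app P.p₀ r) P.ff) (h₁ : DefinedLe (P.app P.p₁ r) x)
      (hu : DefinedLe (f x) u) (h : Dialogue f (fun l => K (u :: l)) c) : Dialogue f K c

variable {P}

theorem Dialogue.ret_pair {f : A → Part A} {K : List A → Part A} {c : A}
    (h : DefinedLe (K []) (P.pair P.tt c)) : P.Dialogue f K c :=
  .ret h (p₀_pair _ _) (p₁_pair _ _)

theorem Dialogue.ask_pair {f : A → Part A} {K : List A → Part A} {x u c : A}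
    (h : DefinedLe (K []) (P.pair P.ff x)) (hu : DefinedLe (f x) u)
    (hc : P.Dialogue f (fun l => K (u :: l)) c) : P.Dialogue f K c :=
  .ask h (p₀_pair _ _) (p₁_pair _ _) hu hc

/-- Transfers a dialogue to any strategy that simulates the given one move by move; this is how
interrogators are compared below. -/
theorem Dialogue.of_kleeneLe {f : A → Part A} {K K' : List A → Part A} {c : A}
    (h : P.Dialogue f K c) (hK : ∀ l, KleeneLe (K' l) (K l)) : P.Dialogue f K' c := by
  induction h generalizing K' with
  | ret hr h₀ h₁ => exact .ret (hr.of_kleeneLe (hK _)) h₀ h₁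
  | ask hr h₀ h₁ hu _ ih =>
    exact .ask (hr.of_kleeneLe (hK _)) h₀ h₁ hu (ih fun l => hK _)

theorem Dialogue.mono {f : A → Part A} {K : List A → Part A} {c d : A}
    (h : P.Dialogue f K c) (hcd : c ≤ d) : P.Dialogue f K d := by
  induction h with
  | ret hr h₀ h₁ => exact .ret hr h₀ (h₁.mono hcd)
  | ask hr h₀ h₁ hu _ ih => exact .ask hr h₀ h₁ hu (ih hcd)

theorem exists_of_bind_app {e : Part A} {r s x : A} (h : DefinedLe (e.bind (P.app r)) x) {y : A}
    (h' : y ∈ e.bind (P.app s)) :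
    ∃ z ∈ e, DefinedLe (P.app r z) x ∧ y ∈ P.app s z := by
  obtain ⟨w, hw, hwx⟩ := h
  obtain ⟨z, hz, hzw⟩ := Part.mem_bind_iff.1 hw
  obtain ⟨z', hz', hzy⟩ := Part.mem_bind_iff.1 h'
  obtain rfl := Part.mem_unique hz hz'
  exact ⟨z, hz, ⟨w, hzw, hwx⟩, hzy⟩

/-- Induction on the answers v still to come, with the answers w already given as a parameter. -/
theorem dialogue_of_computes {q f : A → Part A} {b c : A} (h : P.Computes q f b c) :
    P.Dialogue f (fun l => q (P.code (b :: l))) c := by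
  obtain ⟨u, hu, hut, huc⟩ := h
  have key : ∀ v w : List A, w ++ v = u →
      P.Dialogue f (fun l => q (P.code (b :: (w ++ l)))) c := by
    intro v
    induction v with
    | nil =>
      intro w hw
      obtain ⟨r, hr, h₀, h₁⟩ := exists_of_bind_app hut huc
      refine .ret (.of_mem (x := r) ?_) h₀ (.of_mem h₁)
      rwa [hw]
    | cons a v ih =>
      intro w hw
      have hlt : w.length < u.length := by simp [← hw]
      obtain ⟨hbot, hans⟩ := hu w.length hlt
      have htake : u.take w.length = w := by simp [← hw]
      have hget : u[w.length] = a := by simp [← hw]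
      rw [htake] at hbot hans
      rw [hget] at hans
      obtain ⟨x, hx, hfx⟩ := Part.mem_bind_iff.1 hans
      obtain ⟨r, hr, h₀, h₁⟩ := exists_of_bind_app hbot hx
      refine .ask (.of_mem (x := r) (by simpa using hr)) h₀ (.of_mem h₁) (.of_mem hfx) ?_
      simpa using ih (w ++ [a]) (by simpa using hw)
  exact key u [] rfl

/-- The list v holds the true answers of the oracle, which may lie strictly below those recorded in
the dialogue. The invariant `hK` says that the interrogator, continued after v, still does at least
as well as the remaining strategy; monotonicity of codes preserves it. -/
theorem Dialogue.definedLe_oracleApp (hP : ¬ P.Semitrivial) {q f : A → Part A} {b c : A}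
    {K : List A → Part A}
    (hq : ∀ {x' x : A}, x' ≤ x → KleeneLe (q x') (q x))
    (hf : ∀ {x' x : A}, x' ≤ x → KleeneLe (f x') (f x))
    (h : P.Dialogue f K c) (v : List A) (hv : P.IsInterrogation q f b v)
    (hK : ∀ l, KleeneLe (q (P.code (b :: (v ++ l)))) (K l)) :
    DefinedLe (P.oracleApp q f b) c := by
  induction h generalizing v with
  | ret hr h₀ h₁ =>
    have hr' := hr.of_kleeneLe (hK [])
    rw [List.append_nil] at hr'
    obtain ⟨y, hy, hyc⟩ := hr'.bind_app h₁
    exact ⟨y, (P.mem_oracleApp hP).2 ⟨v, hv, hr'.bind_app h₀, hy⟩, hyc⟩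
  | @ask K r x u c hr h₀ h₁ hu _ ih =>
    have hr' := hr.of_kleeneLe (hK [])
    rw [List.append_nil] at hr'
    obtain ⟨y, hy, hyx⟩ := hr'.bind_app h₁
    obtain ⟨w, hw, hwu⟩ := hu.of_kleeneLe (hf hyx)
    refine ih (v ++ [w]) ?_ ?_
    · intro k hk
      rw [List.length_append, List.length_singleton] at hk
      rcases Nat.lt_or_ge k v.length with h | h
      · rw [List.take_append_of_le_length h.le, List.getElem_append_left h]
        exact hv k h
      · obtain rfl : k = v.length := by omega
        rw [List.take_left' rfl, List.getElem_concat_length rfl]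
        exact ⟨hr'.bind_app h₀, Part.mem_bind_iff.2 ⟨y, hy, hw⟩⟩
    · intro l z hz
      refine DefinedLe.of_kleeneLe (hK (u :: l) z hz) ?_
      refine hq (P.code_mono (.cons le_rfl ?_))
      rw [List.append_assoc]
      exact List.rel_append (List.forall₂_same.2 fun _ _ => le_rfl)
        (.cons hwu (List.forall₂_same.2 fun _ _ => le_rfl))

theorem definedLe_oracleApp_iff (hP : ¬ P.Semitrivial) {q f : A → Part A} {b c : A}
    (hq : ∀ {x' x : A}, x' ≤ x → KleeneLe (q x') (q x))
    (hf : ∀ {x' x : A}, x' ≤ x → KleeneLe (f x') (f x)) :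
    DefinedLe (P.oracleApp q f b) c ↔ P.Dialogue f (fun l => q (P.code (b :: l))) c := by
  constructor
  · rintro ⟨d, hd, hdc⟩
    exact (dialogue_of_computes ((P.mem_oracleApp hP).1 hd)).mono hdc
  · intro h
    exact h.definedLe_oracleApp hP hq hf [] (fun m hm => absurd hm (by simp))
      fun l => KleeneLe.refl _

end PCA

namespace PCA

variable {A : Type u} [PartialOrder A] (P : PCA A)

/-! ### Interrogators that need no recursion -/

/-- Replaces the input `p a b` by `b` and interrogates by `a`. -/
def evalQ : A :=
  P.abs (.app (P.fstT (P.headT (.var 0))) (P.consT (P.sndT (P.headT (.var 0))) (P.tailT (.var 0))))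

/-- Asks the input and returns the answer. -/
def copyQ : A :=
  P.abs (P.iteT (P.nullT (P.tailT (.var 0))) (P.askT (P.headT (.var 0)))
    (P.retT (P.headT (P.tailT (.var 0)))))

/-- Returns the input. -/
def idQ : A := P.abs (P.retT (P.headT (.var 0)))

/-- Returns an interrogator that returns the present input. -/
def constQ : A := P.abs (P.retT (P.lam (P.retT (P.headT (.var 0)))))

/-- Interrogates by the input, on the input `i`. -/
def forceQ : A := P.abs (.app (P.headT (.var 0)) (P.consT (.const P.i) (P.tailT (.var 0))))

/-- Returns `r b` for the input `b`. -/
def liftQ (r : A) : A := P.abs (P.retT (.app (.const r) (P.headT (.var 0))))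

/-- With an oracle for `p b a ↦ b ⊙ a`, a function that asks a constant oracle for `b` and then
returns `b ⊙ a`. -/
def counitQ : A :=
  P.abs (P.iteT (P.nullT (P.tailT (.var 0)))
    (P.iteT (P.nullT (P.tailT (P.headT (.var 0)))) (P.retT (P.askT (.const P.i)))
      (P.askT (P.pairT (P.headT (P.tailT (P.headT (.var 0)))) (P.headT (P.headT (.var 0))))))
    (P.retT (P.retT (P.headT (P.tailT (.var 0))))))

/-- With an oracle for `p b a ↦ b ⊙ a`, a function that asks a constant oracle for `b` and then
computes a function that asks a constant oracle for `a` and returns `b ⊙ a`. -/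
def appQ : A :=
  P.abs (P.iteT (P.nullT (P.tailT (.var 0)))
    (P.iteT (P.nullT (P.tailT (P.headT (.var 0)))) (P.retT (P.askT (.const P.i)))
      (P.iteT (P.nullT (P.tailT (P.headT (P.headT (.var 0))))) (P.retT (P.retT (P.askT (.const P.i))))
        (P.askT (P.pairT (P.headT (P.tailT (P.headT (.var 0))))
          (P.headT (P.tailT (P.headT (P.headT (.var 0)))))))))
    (P.retT (P.retT (P.retT (P.headT (P.tailT (.var 0)))))))

variable {P}

theorem evalQ_mem : P.evalQ ∈ P.sharp :=
  P.abs_mem _ (.app (constsIn_fstT (constsIn_headT (.var _)))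
    (constsIn_consT (constsIn_sndT (constsIn_headT (.var _))) (constsIn_tailT (.var _))))

theorem copyQ_mem : P.copyQ ∈ P.sharp :=
  P.abs_mem _ (constsIn_iteT (constsIn_nullT (constsIn_tailT (.var _)))
    (constsIn_askT (constsIn_headT (.var _)))
    (constsIn_retT (constsIn_headT (constsIn_tailT (.var _)))))

theorem idQ_mem : P.idQ ∈ P.sharp := P.abs_mem _ (constsIn_retT (constsIn_headT (.var _)))

theorem constQ_mem : P.constQ ∈ P.sharp :=
  P.abs_mem _ (constsIn_retT (P.constsIn_lam _ (constsIn_retT (constsIn_headT (.var _)))))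

theorem forceQ_mem : P.forceQ ∈ P.sharp :=
  P.abs_mem _ (.app (constsIn_headT (.var _))
    (constsIn_consT (.const P.i_mem) (constsIn_tailT (.var _))))

theorem liftQ_mem {r : A} (hr : r ∈ P.sharp) : P.liftQ r ∈ P.sharp :=
  P.abs_mem _ (constsIn_retT (.app (.const hr) (constsIn_headT (.var _))))

theorem counitQ_mem : P.counitQ ∈ P.sharp :=
  P.abs_mem _ (constsIn_iteT (constsIn_nullT (constsIn_tailT (.var _)))
    (constsIn_iteT (constsIn_nullT (constsIn_tailT (constsIn_headT (.var _))))
      (constsIn_retT (constsIn_askT (.const P.i_mem)))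
      (constsIn_askT (constsIn_pairT (constsIn_headT (constsIn_tailT (constsIn_headT (.var _))))
        (constsIn_headT (constsIn_headT (.var _))))))
    (constsIn_retT (constsIn_retT (constsIn_headT (constsIn_tailT (.var _))))))

theorem appQ_mem : P.appQ ∈ P.sharp :=
  P.abs_mem _ (constsIn_iteT (constsIn_nullT (constsIn_tailT (.var _)))
    (constsIn_iteT (constsIn_nullT (constsIn_tailT (constsIn_headT (.var _))))
      (constsIn_retT (constsIn_askT (.const P.i_mem)))
      (constsIn_iteT (constsIn_nullT (constsIn_tailT (constsIn_headT (constsIn_headT (.var _)))))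
        (constsIn_retT (constsIn_retT (constsIn_askT (.const P.i_mem))))
        (constsIn_askT (constsIn_pairT (constsIn_headT (constsIn_tailT (constsIn_headT (.var _))))
          (constsIn_headT (constsIn_tailT (constsIn_headT (constsIn_headT (.var _)))))))))
    (constsIn_retT (constsIn_retT (constsIn_retT (constsIn_headT (constsIn_tailT (.var _)))))))

theorem evalQ_app {a b c : A} {l : List A} (h : DefinedLe (P.app a (P.code (b :: l))) c) :
    DefinedLe (P.app P.evalQ (P.code (P.pair a b :: l))) c :=
  abs_app (ev_app (ev_fst (ev_head (ev_var le_rfl)))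
    (ev_cons (ev_snd (ev_head (ev_var le_rfl))) (ev_tail (ev_var le_rfl))) h)

theorem copyQ_nil (a : A) : DefinedLe (P.app P.copyQ (P.code [a])) (P.pair P.ff a) :=
  abs_app (ev_ite_true (ev_null_nil (ev_tail (ev_var le_rfl))) (ev_ask (ev_head (ev_var le_rfl))))

theorem copyQ_cons (a u : A) (l : List A) :
    DefinedLe (P.app P.copyQ (P.code (a :: u :: l))) (P.pair P.tt u) :=
  abs_app (ev_ite_false (ev_null_cons (ev_tail (ev_var le_rfl)))
    (ev_ret (ev_head (ev_tail (ev_var le_rfl)))))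

theorem idQ_app (a : A) (l : List A) :
    DefinedLe (P.app P.idQ (P.code (a :: l))) (P.pair P.tt a) :=
  abs_app (ev_ret (ev_head (ev_var le_rfl)))

theorem constQ_app (a : A) (l : List A) :
    ∃ v, DefinedLe (P.app P.constQ (P.code (a :: l))) (P.pair P.tt v) ∧
      ∀ w, DefinedLe (P.app v w) (P.pair P.tt a) :=
  ⟨_, abs_app (ev_ret ev_lam), fun _ => lamVal_app (ev_ret (ev_head (ev_var le_rfl)))⟩

theorem forceQ_app {b c : A} {l : List A} (h : DefinedLe (P.app b (P.code (P.i :: l))) c) :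
    DefinedLe (P.app P.forceQ (P.code (b :: l))) c :=
  abs_app (ev_app (ev_head (ev_var le_rfl)) (ev_cons ev_const (ev_tail (ev_var le_rfl))) h)

theorem liftQ_app {r a c : A} {l : List A} (h : DefinedLe (P.app r a) c) :
    DefinedLe (P.app (P.liftQ r) (P.code (a :: l))) (P.pair P.tt c) :=
  abs_app (ev_ret (ev_app ev_const (ev_head (ev_var le_rfl)) h))

/-- Codes are nested, one level per layer of application. A ⊤-pair ends the dialogue with `evalFun`,
and its value is in turn a move in the dialogue with the constant oracle: here, a question whose
content `i` is arbitrary. -/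
theorem counitQ_nil (a : A) :
    DefinedLe (P.app P.counitQ (P.code [P.code [a]])) (P.pair P.tt (P.pair P.ff P.i)) :=
  abs_app (ev_ite_true (ev_null_nil (ev_tail (ev_var le_rfl)))
    (ev_ite_true (ev_null_nil (ev_tail (ev_head (ev_var le_rfl)))) (ev_ret (ev_ask ev_const))))

theorem counitQ_ask (a b : A) (l : List A) :
    DefinedLe (P.app P.counitQ (P.code [P.code (a :: b :: l)])) (P.pair P.ff (P.pair b a)) :=
  abs_app (ev_ite_true (ev_null_nil (ev_tail (ev_var le_rfl)))
    (ev_ite_false (ev_null_cons (ev_tail (ev_head (ev_var le_rfl))))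
      (ev_ask (ev_pair (ev_head (ev_tail (ev_head (ev_var le_rfl))))
        (ev_head (ev_head (ev_var le_rfl)))))))

theorem counitQ_ret (w y : A) (l : List A) :
    DefinedLe (P.app P.counitQ (P.code (w :: y :: l))) (P.pair P.tt (P.pair P.tt y)) :=
  abs_app (ev_ite_false (ev_null_cons (ev_tail (ev_var le_rfl)))
    (ev_ret (ev_ret (ev_head (ev_tail (ev_var le_rfl))))))

/-- There are three layers: `evalFun` innermost, then the constant oracle for a, then the one for b.
The number of outer ⊤-pairs determines the layer that a question reaches. -/
theorem appQ_nil (v : A) :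
    DefinedLe (P.app P.appQ (P.code [P.code [v]])) (P.pair P.tt (P.pair P.ff P.i)) :=
  abs_app (ev_ite_true (ev_null_nil (ev_tail (ev_var le_rfl)))
    (ev_ite_true (ev_null_nil (ev_tail (ev_head (ev_var le_rfl)))) (ev_ret (ev_ask ev_const))))

theorem appQ_nil_nil (x a : A) (l : List A) :
    DefinedLe (P.app P.appQ (P.code [P.code (P.code [x] :: a :: l)]))
      (P.pair P.tt (P.pair P.tt (P.pair P.ff P.i))) :=
  abs_app (ev_ite_true (ev_null_nil (ev_tail (ev_var le_rfl)))
    (ev_ite_false (ev_null_cons (ev_tail (ev_head (ev_var le_rfl))))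
      (ev_ite_true (ev_null_nil (ev_tail (ev_head (ev_head (ev_var le_rfl)))))
        (ev_ret (ev_ret (ev_ask ev_const))))))

theorem appQ_ask (x u a : A) (l l' : List A) :
    DefinedLe (P.app P.appQ (P.code [P.code (P.code (x :: u :: l') :: a :: l)]))
      (P.pair P.ff (P.pair a u)) :=
  abs_app (ev_ite_true (ev_null_nil (ev_tail (ev_var le_rfl)))
    (ev_ite_false (ev_null_cons (ev_tail (ev_head (ev_var le_rfl))))
      (ev_ite_false (ev_null_cons (ev_tail (ev_head (ev_head (ev_var le_rfl)))))
        (ev_ask (ev_pair (ev_head (ev_tail (ev_head (ev_var le_rfl))))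
          (ev_head (ev_tail (ev_head (ev_head (ev_var le_rfl))))))))))

theorem appQ_ret (w y : A) (l : List A) :
    DefinedLe (P.app P.appQ (P.code (w :: y :: l))) (P.pair P.tt (P.pair P.tt (P.pair P.tt y))) :=
  abs_app (ev_ite_false (ev_null_cons (ev_tail (ev_var le_rfl)))
    (ev_ret (ev_ret (ev_ret (ev_head (ev_tail (ev_var le_rfl)))))))

end PCA

namespace PCA

variable {A : Type u} [PartialOrder A] (P : PCA A)

/-! ### Simulation of oracle computations -/

/-- The call-by-value fixed point combinator. -/
def fixE : A :=
  P.abs (.app (P.lam (P.lam (.app (.app (.var 0) (.app (.var 1) (.var 1))) (.var 2))))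
    (P.lam (P.lam (.app (.app (.var 0) (.app (.var 1) (.var 1))) (.var 2)))))

/-- The element `λ* a b. v` with `v` defined recursively by `v y = t(a, b, v, y)`. -/
def recE (t : PTerm A 4) : A := P.abs (P.lam (.app (.const P.fixE) (P.lam (P.lam t))))

/-- `λ* x l. cons x l`, on codes. -/
def consE : A := P.abs (P.lam (P.consT (.var 0) (.var 1)))

/-- `λ* y u l. y (cons u l)`, on codes. -/
def snocE : A := P.abs (P.lam (P.lam (.app (.var 0) (P.consT (.var 1) (.var 2)))))

/-- The body of the recursion for `runE`. -/
def runT : PTerm A 4 :=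
  -- Variables 0 to 4 are g, κ, the recursive value, y and l; higher ones are dummies bound by
  -- `iteT`. The current move is g (y []), recomputed wherever it is needed.
  P.lam (P.iteT (P.fstT (.app (.var 0) (.app (.var 3) (.const (P.code [])))))
    (.app (.app (.var 1) (P.sndT (.app (.var 0) (.app (.var 3) (.const (P.code [])))))) (.var 4))
    (P.iteT (P.nullT (.var 4))
      (P.askT (P.sndT (.app (.var 0) (.app (.var 3) (.const (P.code []))))))
      (.app (.app (.var 2) (.app (.app (.const P.snocE) (.var 3)) (P.headT (.var 4))))
        (P.tailT (.var 4)))))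

/-- `runE g κ y l` continues the interrogation by `g` in the position `y`, using the answers in
`l`; the result and the remaining answers are passed to `κ`. -/
def runE : A := P.recE P.runT

/-- The body of the recursion for `simE`. -/
def simT : PTerm A 4 :=
  -- Variables 0 to 3 are s, t, the recursive value and y. Variable 4 is the move of α found by
  -- running s, variable 5 the dummy of `iteT`, and variable 6 in the last continuation the answer
  -- of β found by running t.
  .app (.app (.app (.const P.runE) (.var 0))
    (P.lam (P.iteT (P.fstT (.var 4))
      (P.lam (P.retT (P.sndT (.var 4))))
      (.app (.app (.app (.const P.runE) (.var 1))
        (P.lam (.app (.var 2) (.app (.app (.const P.snocE) (.var 3)) (.var 6)))))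
        (.app (.const P.consE) (P.sndT (.var 4)))))))
    (.app (.const P.consE) (.app (.var 3) (.const (P.code []))))

/-- `simE s t y l` simulates, from the position `y`, the interrogation of the function represented
by `t` by the one represented by `s`, using the answers in `l`. -/
def simE : A := P.recE P.simT

/-- Composes representers of functions. -/
def compQ : A :=
  P.abs (P.retT (P.lam (P.retT (P.lam (.app (.app (.app (.app (.const P.simE) (P.headT (.var 0)))
    (P.headT (.var 1))) (.app (.const P.consE) (P.headT (.var 2)))) (P.tailT (.var 2)))))))

variable {P}

theorem fixE_mem : P.fixE ∈ P.sharp :=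
  have h := P.constsIn_lam _ (P.constsIn_lam _
    (.app (.app (.var 0) (.app (.var 1) (.var 1))) (.var 2)))
  P.abs_mem _ (.app h h)

theorem recE_mem {t : PTerm A 4} (ht : t.ConstsIn P.sharp) : P.recE t ∈ P.sharp :=
  P.abs_mem _ (P.constsIn_lam _
    (.app (.const fixE_mem) (P.constsIn_lam _ (P.constsIn_lam _ ht))))

theorem consE_mem : P.consE ∈ P.sharp :=
  P.abs_mem _ (P.constsIn_lam _ (constsIn_consT (.var _) (.var _)))

theorem snocE_mem : P.snocE ∈ P.sharp :=
  P.abs_mem _ (P.constsIn_lam _ (P.constsIn_lam _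
    (.app (.var _) (constsIn_consT (.var _) (.var _)))))

theorem runE_mem : P.runE ∈ P.sharp := by
  have h : ∀ n (i j : Fin n), (PTerm.app (.var i) (.app (.var j) (.const (P.code [])))).ConstsIn
      P.sharp := fun _ _ _ => .app (.var _) (.app (.var _) (.const code_nil_mem))
  exact recE_mem (P.constsIn_lam _ (constsIn_iteT (constsIn_fstT (h _ _ _))
    (.app (.app (.var _) (constsIn_sndT (h _ _ _))) (.var _))
    (constsIn_iteT (constsIn_nullT (.var _)) (constsIn_askT (constsIn_sndT (h _ _ _)))
      (.app (.app (.var _) (.app (.app (.const snocE_mem) (.var _)) (constsIn_headT (.var _))))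
        (constsIn_tailT (.var _))))))

theorem simE_mem : P.simE ∈ P.sharp :=
  recE_mem (.app (.app (.app (.const runE_mem) (.var _))
    (P.constsIn_lam _ (constsIn_iteT (constsIn_fstT (.var _))
      (P.constsIn_lam _ (constsIn_retT (constsIn_sndT (.var _))))
      (.app (.app (.app (.const runE_mem) (.var _))
        (P.constsIn_lam _ (.app (.var _) (.app (.app (.const snocE_mem) (.var _)) (.var _)))))
        (.app (.const consE_mem) (constsIn_sndT (.var _)))))))
    (.app (.const consE_mem) (.app (.var _) (.const code_nil_mem))))

theorem compQ_mem : P.compQ ∈ P.sharp :=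
  P.abs_mem _ (constsIn_retT (P.constsIn_lam _ (constsIn_retT (P.constsIn_lam _
    (.app (.app (.app (.app (.const simE_mem) (constsIn_headT (.var _))) (constsIn_headT (.var _)))
      (.app (.const consE_mem) (constsIn_headT (.var _)))) (constsIn_tailT (.var _)))))))

/-- The fixed point v is an abstraction, so it is defined for every h, and h v is evaluated only
when v receives an argument. -/
theorem fixE_app (h : A) : ∃ v, DefinedLe (P.app P.fixE h) v ∧
    ∀ {w y c}, DefinedLe (P.app h v) w → DefinedLe (P.app w y) c → DefinedLe (P.app v y) c :=
  ⟨_, abs_app (ev_app ev_lam ev_lam (lamVal_app ev_lam)), fun hw hc =>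
    lamVal_app (ev_app (ev_app (ev_var le_rfl)
      (ev_app (ev_var le_rfl) (ev_var le_rfl) (lamVal_app ev_lam)) hw) (ev_var le_rfl) hc)⟩

theorem recE_app (t : PTerm A 4) (a b : A) : ∃ z v, DefinedLe (P.app (P.recE t) a) z ∧
    DefinedLe (P.app z b) v ∧ ∀ {y c},
      DefinedLe (P.eval t (Fin.snoc (Fin.snoc (Fin.snoc (Fin.snoc Fin.elim0 a) b) v) y)) c →
      DefinedLe (P.app v y) c := by
  obtain ⟨v, hv, hv'⟩ := fixE_app (P := P)
    (P.lamVal (P.lam t) (Fin.snoc (Fin.snoc Fin.elim0 a : Fin 1 → A) b))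
  exact ⟨_, v, abs_app ev_lam, lamVal_app (ev_app ev_const ev_lam hv), fun h =>
    hv' (lamVal_app ev_lam) (lamVal_app h)⟩

/-- The element `y` prepends `l` to codes of sequences. -/
def Prepends (P : PCA A) (y : A) (l : List A) : Prop :=
  ∀ l', DefinedLe (P.app y (P.code l')) (P.code (l ++ l'))

theorem consE_app (x : A) : ∃ y, DefinedLe (P.app P.consE x) y ∧ P.Prepends y [x] :=
  ⟨_, abs_app ev_lam, fun _ => lamVal_app (ev_cons (ev_var le_rfl) (ev_var le_rfl))⟩

theorem snocE_app {y : A} {l : List A} (hy : P.Prepends y l) (u : A) :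
    ∃ z y', DefinedLe (P.app P.snocE y) z ∧ DefinedLe (P.app z u) y' ∧
      P.Prepends y' (l ++ [u]) := by
  refine ⟨_, _, abs_app ev_lam, lamVal_app ev_lam, fun l' => ?_⟩
  rw [List.append_assoc]
  exact lamVal_app (ev_app (ev_var le_rfl) (ev_cons (ev_var le_rfl) (ev_var le_rfl)) (hy _))

theorem Prepends.app_nil {y : A} {l : List A} (hy : P.Prepends y l) :
    DefinedLe (P.app y (P.code [])) (P.code l) := by
  simpa using hy []

theorem ev_app₂ {n : ℕ} {e : Fin n → A} {t₀ t₁ t₂ : PTerm A n} {x y z c : A}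
    (h₀ : DefinedLe (P.eval t₀ e) x) (h₁ : DefinedLe (P.eval t₁ e) y)
    (h₂ : DefinedLe (P.eval t₂ e) z) (h : DefinedLe (P.mul (P.app x y) (Part.some z)) c) :
    DefinedLe (P.eval (.app (.app t₀ t₁) t₂) e) c := by
  obtain ⟨c', hc', hcc⟩ := h
  obtain ⟨w, hw, z', hz', hwz⟩ := P.mem_mul.1 hc'
  rw [Part.mem_some_iff] at hz'
  subst hz'
  exact ev_app (ev_app h₀ h₁ (.of_mem hw)) h₂ ⟨c', hwz, hcc⟩

/-- The history l is stored as the prepending function y. Available answers are moved from the list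
into y, and a question is issued only when the list is empty; when g returns, κ inherits the unused
answers. Continuation passing is what lets several runs share one list of answers. -/
theorem runE_app (g κ : A) : ∃ z v, DefinedLe (P.app P.runE g) z ∧ DefinedLe (P.app z κ) v ∧
    ∀ {f : A → Part A} {y c d : A} {l : List A}, P.Prepends y l →
      P.Dialogue f (fun l' => P.app g (P.code (l ++ l'))) c →
      P.Dialogue f (fun l' => P.mul (P.app κ c) (Part.some (P.code l'))) d →
      P.Dialogue f (fun l' => P.mul (P.app v y) (Part.some (P.code l'))) d := by
  obtain ⟨z, v, hz, hv, hrec⟩ := recE_app P.runT g κ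
  refine ⟨z, v, hz, hv, ?_⟩
  intro f y c d l hy hK hκ
  generalize hKl : (fun l' => P.app g (P.code (l ++ l'))) = K at hK
  replace hKl : ∀ l', P.app g (P.code (l ++ l')) = K l' := fun l' => congrFun hKl l'
  induction hK generalizing y l with
  | ret hr h₀ h₁ =>
    rw [← hKl, List.append_nil] at hr
    refine hκ.of_kleeneLe fun l' d' hd' => ?_
    refine P.definedLe_mul_some (hrec ev_lam) (lamVal_app (ev_ite_true ?_ ?_))
    · exact ev_app ev_const (ev_app (ev_var le_rfl)
        (ev_app (ev_var le_rfl) ev_const hy.app_nil) hr) h₀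
    · exact ev_app₂ (ev_var le_rfl) (ev_app ev_const (ev_app (ev_var le_rfl)
        (ev_app (ev_var le_rfl) ev_const hy.app_nil) hr) h₁) (ev_var le_rfl) (.of_mem hd')
  | @ask K r x u c hr h₀ h₁ hu _ ih =>
    rw [← hKl, List.append_nil] at hr
    have hr' : ∀ {n} {e : Fin n → A} {i j}, e i ≤ g → e j ≤ y →
        DefinedLe (P.eval (.app (.var i) (.app (.var j) (.const (P.code [])))) e) r :=
      fun hi hj => ev_app (ev_var hi) (ev_app (ev_var hj) ev_const hy.app_nil) hr
    obtain ⟨w, y', hw, hy', hpre⟩ := snocE_app hy u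
    refine .ask_pair (x := x) ?_ hu ((ih hpre hκ fun l' => by simp [← hKl]).of_kleeneLe
      fun l' d' hd' => ?_)
    · exact P.definedLe_mul_some (hrec ev_lam) (lamVal_app (ev_ite_false
        (ev_app ev_const (hr' le_rfl le_rfl) h₀)
        (ev_ite_true (ev_null_nil (ev_var le_rfl))
          (ev_ask (ev_app ev_const (hr' le_rfl le_rfl) h₁)))))
    · exact P.definedLe_mul_some (hrec ev_lam) (lamVal_app (ev_ite_false
        (ev_app ev_const (hr' le_rfl le_rfl) h₀)
        (ev_ite_false (ev_null_cons (ev_var le_rfl))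
          (ev_app₂ (ev_var le_rfl)
            (ev_app (ev_app ev_const (ev_var le_rfl) hw) (ev_head (ev_var le_rfl)) hy')
            (ev_tail (ev_var le_rfl)) (.of_mem hd')))))

theorem simE_app (s t : A) : ∃ z v, DefinedLe (P.app P.simE s) z ∧ DefinedLe (P.app z t) v ∧
    ∀ {f α β : A → Part A} {y c : A} {l : List A}, P.Prepends y l →
      (∀ a r, DefinedLe (α a) r → P.Dialogue f (fun l' => P.app s (P.code (a :: l'))) r) →
      (∀ a r, DefinedLe (β a) r → P.Dialogue f (fun l' => P.app t (P.code (a :: l'))) r) →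
      P.Dialogue β (fun l' => α (P.code (l ++ l'))) c →
      P.Dialogue f (fun l' => P.mul (P.app v y) (Part.some (P.code l'))) c := by
  obtain ⟨z, v, hz, hv, hrec⟩ := recE_app P.simT s t
  refine ⟨z, v, hz, hv, ?_⟩
  intro f α β y c l hy hα hβ hK
  generalize hKl : (fun l' => α (P.code (l ++ l'))) = K at hK
  replace hKl : ∀ l', α (P.code (l ++ l')) = K l' := fun l' => congrFun hKl l'
  -- One run of s, computing the move r of α at history l. The long term is the continuation in
  -- `simT`, which inspects r.
  have main : ∀ {y l r d}, P.Prepends y l → DefinedLe (α (P.code l)) r →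
      P.Dialogue f (fun l' => P.mul (P.app (P.lamVal (P.iteT (P.fstT (.var 4))
        (P.lam (P.retT (P.sndT (.var 4))))
        (.app (.app (.app (.const P.runE) (.var 1))
          (P.lam (.app (.var 2) (.app (.app (.const P.snocE) (.var 3)) (.var 6)))))
          (.app (.const P.consE) (P.sndT (.var 4)))))
        (Fin.snoc (Fin.snoc (Fin.snoc (Fin.snoc Fin.elim0 s) t) v) y)) r)
          (Part.some (P.code l'))) d →
      P.Dialogue f (fun l' => P.mul (P.app v y) (Part.some (P.code l'))) d := by
    intro y l r d hy hr hd
    obtain ⟨z, w, hz, hw, hrun⟩ := runE_app (P := P) s _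
    obtain ⟨y', hy', hpre⟩ := consE_app (P := P) (P.code l)
    refine (hrun hpre (hα _ _ hr) hd).of_kleeneLe fun l' => ?_
    refine P.mul_mono (fun x hx => ?_) (KleeneLe.refl _)
    exact hrec (ev_app (ev_app (ev_app ev_const (ev_var le_rfl) hz) ev_lam hw)
      (ev_app ev_const (ev_app (ev_var le_rfl) ev_const hy.app_nil) hy') (.of_mem hx))
  induction hK generalizing y l with
  | ret hr h₀ h₁ =>
    rw [← hKl, List.append_nil] at hr
    refine main hy hr (.ret_pair ?_)
    exact P.definedLe_mul_some (lamVal_app (ev_ite_true (ev_app ev_const (ev_var le_rfl) h₀)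
      ev_lam)) (lamVal_app (ev_ret (ev_app ev_const (ev_var le_rfl) h₁)))
  | @ask K r x u c hr h₀ h₁ hu _ ih =>
    rw [← hKl, List.append_nil] at hr
    refine main hy hr ?_
    -- The move r is a question x to β, so t is run on x. Its continuation adds the answer u to the
    -- history and re-enters the recursion; `P.i` fills the dummy variable of `iteT`.
    obtain ⟨z, w, hz, hw, hrun⟩ := runE_app t
      (P.lamVal (.app (.var 2) (.app (.app (.const P.snocE) (.var 3)) (.var 6)))
        (Fin.snoc (Fin.snoc (Fin.snoc (Fin.snoc (Fin.snoc (Fin.snoc Fin.elim0 s) t) v) y) r) P.i))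
    obtain ⟨y', hy', hpre'⟩ := consE_app (P := P) x
    obtain ⟨z'', y'', hz'', hy'', hpre⟩ := snocE_app hy u
    refine (hrun hpre' (hβ _ _ hu) ((ih hpre fun l' => by simp [← hKl]).of_kleeneLe
      fun l' => ?_)).of_kleeneLe fun l' => P.mul_mono (fun a ha => ?_) (KleeneLe.refl _)
    · exact P.mul_mono (fun a ha => lamVal_app (ev_app (ev_var le_rfl)
        (ev_app (ev_app ev_const (ev_var le_rfl) hz'') (ev_var le_rfl) hy'') (.of_mem ha)))
        (KleeneLe.refl _)
    · exact lamVal_app (ev_ite_false (ev_app ev_const (ev_var le_rfl) h₀)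
        (ev_app (ev_app (ev_app ev_const (ev_var le_rfl) hz) ev_lam hw)
          (ev_app ev_const (ev_app ev_const (ev_var le_rfl) h₁) hy') (.of_mem ha)))

theorem compQ_app (s : A) (l₀ : List A) : ∃ v,
    DefinedLe (P.app P.compQ (P.code (s :: l₀))) (P.pair P.tt v) ∧
    ∀ t l₁, ∃ w, DefinedLe (P.app v (P.code (t :: l₁))) (P.pair P.tt w) ∧
    ∀ {f α β : A → Part A} {b c : A},
      (∀ a r, DefinedLe (α a) r → P.Dialogue f (fun l' => P.app s (P.code (a :: l'))) r) →
      (∀ a r, DefinedLe (β a) r → P.Dialogue f (fun l' => P.app t (P.code (a :: l'))) r) →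
      P.Dialogue β (fun l' => α (P.code (b :: l'))) c →
      P.Dialogue f (fun l' => P.app w (P.code (b :: l'))) c := by
  refine ⟨_, abs_app (ev_ret ev_lam), fun t l₁ => ⟨_, lamVal_app (ev_ret ev_lam), ?_⟩⟩
  obtain ⟨z, v, hz, hv, hsim⟩ := simE_app (P := P) s t
  intro f α β b c hα hβ h
  obtain ⟨y, hy, hpre⟩ := consE_app (P := P) b
  refine (hsim hpre hα hβ h).of_kleeneLe fun l' d hd => ?_
  exact lamVal_app (ev_app₂ (ev_app (ev_app ev_const (ev_head (ev_var le_rfl)) hz)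
    (ev_head (ev_var le_rfl)) hv) (ev_app ev_const (ev_head (ev_var le_rfl)) hy)
    (ev_tail (ev_var le_rfl)) (.of_mem hd))

end PCA

/-! ### Realizers on downsets, checked elementwise -/

section Downsets

variable {A : Type u} {B : Type v} [PartialOrder A] [PartialOrder B]

/-- It suffices to test the generator t of the principal downset, because application is monotone
and Y is a downset. -/
theorem PAP.definedLe_downApp_iff (Q : PAP B) {t : B} {X Y : LowerSet B} :
    DefinedLe (Q.downApp (LowerSet.Iic t) X) Y ↔ ∀ x ∈ X, ∃ y ∈ Y, DefinedLe (Q.app t x) y := by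
  constructor
  · rintro ⟨_, ⟨hd, rfl⟩, hle⟩ x hx
    have hdom := hd t (LowerSet.mem_Iic_iff.2 le_rfl) x hx
    exact ⟨_, hle (subset_lowerClosure ⟨t, LowerSet.mem_Iic_iff.2 le_rfl, x, hx,
      Part.get_mem hdom⟩), .of_mem (Part.get_mem hdom)⟩
  · intro h
    have key : ∀ t' ≤ t, ∀ x ∈ X, ∃ z ∈ Q.app t' x, z ∈ Y := by
      intro t' ht' x hx
      obtain ⟨y, hy, hxy⟩ := h x hx
      obtain ⟨z, hz, hzy⟩ := Q.definedLe_app hxy ht' le_rfl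
      exact ⟨z, hz, Y.lower hzy hy⟩
    refine ⟨_, ⟨fun t' ht' x hx => ?_, rfl⟩, lowerClosure_le.2 ?_⟩
    · obtain ⟨z, hz, -⟩ := key t' ht' x hx
      exact Part.dom_iff_mem.2 ⟨z, hz⟩
    · rintro c ⟨t', ht', x, hx, hc⟩
      obtain ⟨z, hz, hzY⟩ := key t' ht' x hx
      rwa [Part.mem_unique hc hz]

theorem PAP.definedLe_downApp_bind (Q : PAP B) {t : B} {X X' Y : LowerSet B}
    (h : ∀ x ∈ X, ∃ z, DefinedLe (Q.app t x) z ∧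
      ∀ x' ∈ X', ∃ y ∈ Y, DefinedLe (Q.app z x') y) :
    DefinedLe ((Q.downApp (LowerSet.Iic t) X).bind fun γ => Q.downApp γ X') Y := by
  have key : ∀ t' ≤ t, ∀ x ∈ X, ∃ z ∈ Q.app t' x,
      ∀ z' ≤ z, ∀ x' ∈ X', ∃ y ∈ Q.app z' x', y ∈ Y := by
    intro t' ht' x hx
    obtain ⟨z, hz, hzX⟩ := h x hx
    obtain ⟨w, hw, hwz⟩ := Q.definedLe_app hz ht' le_rfl
    refine ⟨w, hw, fun z' hz' x' hx' => ?_⟩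
    obtain ⟨y, hy, hxy⟩ := hzX x' hx'
    obtain ⟨c, hc, hcy⟩ := Q.definedLe_app hxy (hz'.trans hwz) le_rfl
    exact ⟨c, hc, Y.lower hcy hy⟩
  have hd : (Q.downApp (LowerSet.Iic t) X).Dom := by
    intro t' ht' x hx
    obtain ⟨z, hz, -⟩ := key t' ht' x hx
    exact Part.dom_iff_mem.2 ⟨z, hz⟩
  have hγ : ∀ z' ∈ (Q.downApp (LowerSet.Iic t) X).get hd, ∀ x' ∈ X',
      ∃ y ∈ Q.app z' x', y ∈ Y := by
    rintro z' ⟨c, ⟨t', ht', x, hx, hc⟩, hz'⟩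
    obtain ⟨z, hz, hzX⟩ := key t' ht' x hx
    obtain rfl := Part.mem_unique hc hz
    exact hzX z' hz'
  refine ⟨_, Part.mem_bind_iff.2 ⟨_, Part.get_mem hd, ⟨fun z' hz' x' hx' => ?_, rfl⟩⟩,
    lowerClosure_le.2 ?_⟩
  · obtain ⟨y, hy, -⟩ := hγ z' hz' x' hx'
    exact Part.dom_iff_mem.2 ⟨y, hy⟩
  · rintro c ⟨z', hz', x', hx', hc⟩
    obtain ⟨y, hy, hyY⟩ := hγ z' hz' x' hx'
    rwa [Part.mem_unique hc hy]

theorem PAP.representsVia_principal_iff (Q : PAP A) {s : A} {α : MonoPFun A} :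
    Q.RepresentsVia principal s α ↔ Q.Represents s α := by
  refine forall₂_congr fun a c => ?_
  refine imp_congr_right fun _ => Q.definedLe_downApp_iff.trans ⟨fun h => ?_, fun h x hx => ?_⟩
  · obtain ⟨y, hy, hay⟩ := h a (LowerSet.mem_Iic_iff.2 le_rfl)
    exact hay.mono (LowerSet.mem_Iic_iff.1 hy)
  · exact ⟨c, LowerSet.mem_Iic_iff.2 le_rfl,
      Q.definedLe_app h le_rfl (LowerSet.mem_Iic_iff.1 hx)⟩

theorem PAP.mem_representers_principal (Q : PAP A) {s : A} {α : MonoPFun A} :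
    s ∈ Q.representers principal α ↔ Q.Represents s α :=
  Q.representsVia_principal_iff

theorem PAP.Represents.mono {Q : PAP A} {s : A} {α β : MonoPFun A} (h : Q.Represents s α)
    (hαβ : α ≤ β) : Q.Represents s β := fun a c hc => by
  obtain ⟨d, hd, hdc⟩ := hαβ a c hc
  exact DefinedLe.mono (h a d hd) hdc

theorem mem_principal {a b : A} : a ∈ principal b ↔ a ≤ b := LowerSet.mem_Iic_iff

theorem mem_compMorphism {C : Type*} [PartialOrder C] {g : B → LowerSet C} {h : A → LowerSet B}
    {a : A} {c : C} : c ∈ compMorphism g h a ↔ ∃ b ∈ h a, c ∈ g b := by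
  simp [compMorphism]

theorem MonoPFun.le_const_iff {β : MonoPFun A} {a : A} :
    β ≤ const a ↔ ∀ x, DefinedLe (β.toFun x) a :=
  ⟨fun h x => h x a (Part.mem_some a), fun h x c hc => by
    rw [Part.mem_some_iff.1 hc]
    exact h x⟩

end Downsets

/-! ### Applications in `𝓑A[f]` and `A[f]` as dialogues -/

namespace PCA

variable {A : Type u} [PartialOrder A] {P : PCA A} (hP : ¬ P.Semitrivial)

/-- The partial function `a ↦ r a`. -/
def leftMul (P : PCA A) (r : A) : MonoPFun A := ⟨P.app r, fun h => P.app_mono le_rfl h⟩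

/-- The application of `𝓑A`. -/
noncomputable def funApp (α β : MonoPFun A) : MonoPFun A where
  toFun := P.oracleApp α.toFun β.toFun
  mono := fun hab => P.oracleApp_mono hP α.mono β.mono hab

theorem funApp_mem_app (α β : MonoPFun A) :
    funApp hP α β ∈ (P.funPAP hP).app α β :=
  Part.mem_some _

theorem mem_app_iff {α β γ : MonoPFun A} :
    γ ∈ (P.funPAP hP).app α β ↔ γ = funApp hP α β :=
  Part.mem_some_iff

theorem definedLe_funApp_iff {α β : MonoPFun A} {a c : A} :
    DefinedLe ((funApp hP α β).toFun a) c ↔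
      P.Dialogue β.toFun (fun l => α.toFun (P.code (a :: l))) c :=
  definedLe_oracleApp_iff hP α.mono β.mono

theorem definedLe_adjoinFun_iff {f : MonoPFun A} {a b c : A} :
    DefinedLe ((P.adjoinFun hP f).app a b) c ↔
      P.Dialogue f.toFun (fun l => P.app a (P.code (b :: l))) c :=
  definedLe_oracleApp_iff hP (P.app_mono le_rfl) f.mono

variable (f : MonoPFun A)

theorem sharp_subset_adjoinFun : P.sharp ⊆ (P.adjoinFun hP f).sharp :=
  PAP.subset_generate _ _

theorem leftMul_mem {r : A} (hr : r ∈ P.sharp) : P.leftMul r ∈ (P.funAdjoinElem hP f).sharp :=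
  PAP.subset_generate _ _ (Or.inl ⟨r, hr, fun _ => KleeneLe.refl _⟩)

theorem funApp_mem {α β : MonoPFun A} (hα : α ∈ (P.funAdjoinElem hP f).sharp)
    (hβ : β ∈ (P.funAdjoinElem hP f).sharp) : funApp hP α β ∈ (P.funAdjoinElem hP f).sharp :=
  (P.funAdjoinElem hP f).isFilter_sharp.app_mem hα hβ (funApp_mem_app hP α β)

/-! ### Elements of `𝓑A[f]` -/

/-- The function `p a b ↦ a ⊙ b`. -/
noncomputable def evalFun : MonoPFun A := funApp hP (P.leftMul P.evalQ) f

theorem evalFun_mem : evalFun hP f ∈ (P.funAdjoinElem hP f).sharp :=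
  funApp_mem hP f (leftMul_mem hP f evalQ_mem) (PAP.subset_generate _ _ (Or.inr rfl))

variable {f}

theorem evalFun_pair {a b c : A} (h : DefinedLe ((P.adjoinFun hP f).app a b) c) :
    DefinedLe ((evalFun hP f).toFun (P.pair a b)) c :=
  (definedLe_funApp_iff hP).2 (((definedLe_adjoinFun_iff hP).1 h).of_kleeneLe
    fun _ _ hx => evalQ_app (.of_mem hx))

variable (f)

/-- The realizer of the counit. -/
noncomputable def counitFun : MonoPFun A := funApp hP (P.leftMul P.counitQ) (evalFun hP f)

theorem counitFun_mem : counitFun hP f ∈ (P.funAdjoinElem hP f).sharp :=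
  funApp_mem hP f (leftMul_mem hP f counitQ_mem) (evalFun_mem hP f)

/-- The realizer of application. -/
noncomputable def appFun : MonoPFun A := funApp hP (P.leftMul P.appQ) (evalFun hP f)

theorem appFun_mem : appFun hP f ∈ (P.funAdjoinElem hP f).sharp :=
  funApp_mem hP f (leftMul_mem hP f appQ_mem) (evalFun_mem hP f)

variable {f}

theorem funApp_counitFun_le {b : A} {α β : MonoPFun A} (hβ : β ≤ .const b)
    (hb : (P.adjoinFun hP f).Represents b α) : funApp hP (counitFun hP f) β ≤ α := by
  intro a c hc
  refine (definedLe_funApp_iff hP).2 (.ask_pair (x := P.i) (u := b) ?_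
    (MonoPFun.le_const_iff.1 hβ _) (.ret_pair ?_))
  · exact (definedLe_funApp_iff hP).2 (.ret_pair (counitQ_nil a))
  · exact (definedLe_funApp_iff hP).2 (.ask_pair (counitQ_ask a b [])
      (evalFun_pair hP (hb a c hc)) (.ret_pair (counitQ_ret _ c [])))

theorem funApp_appFun_le {a b c : A} {α β : MonoPFun A} (hα : α ≤ .const a) (hβ : β ≤ .const b)
    (hc : c ∈ (P.adjoinFun hP f).app a b) :
    funApp hP (funApp hP (appFun hP f) α) β ≤ .const c := by
  -- The middle layer keeps no state, so it asks α for a anew at every call, both at [x] and at [x,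
  -- b].
  have step : ∀ {v d : A}, DefinedLe ((appFun hP f).toFun (P.code [v, a])) (P.pair P.tt d) →
      DefinedLe ((funApp hP (appFun hP f) α).toFun v) d := fun h =>
    (definedLe_funApp_iff hP).2 (.ask_pair (x := P.i)
      ((definedLe_funApp_iff hP).2 (.ret_pair (appQ_nil _)))
      (MonoPFun.le_const_iff.1 hα _) (.ret_pair h))
  refine MonoPFun.le_const_iff.2 fun x => (definedLe_funApp_iff hP).2
    (.ask_pair (x := P.i) (u := b) (step ?_) (MonoPFun.le_const_iff.1 hβ _) (.ret_pair (step ?_)))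
  · exact (definedLe_funApp_iff hP).2 (.ret_pair (appQ_nil_nil x a []))
  · exact (definedLe_funApp_iff hP).2 (.ask_pair (appQ_ask x b a [] [])
      (evalFun_pair hP (.of_mem hc)) (.ret_pair (appQ_ret _ c [])))

theorem funApp_copyQ_le (α : MonoPFun A) : funApp hP (P.leftMul P.copyQ) α ≤ α := fun a c hc =>
  (definedLe_funApp_iff hP).2
    (.ask_pair (copyQ_nil a) (.of_mem hc) (.ret_pair (copyQ_cons a c [])))

/-! ### Elements of `A[f]` -/

theorem represents_copyQ : (P.adjoinFun hP f).Represents P.copyQ f := fun a c hc =>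
  (definedLe_adjoinFun_iff hP).2
    (.ask_pair (copyQ_nil a) (.of_mem hc) (.ret_pair (copyQ_cons a c [])))

theorem represents_liftQ {r : A} {α : MonoPFun A} (h : P.Represents r α) :
    (P.adjoinFun hP f).Represents (P.liftQ r) α := fun a c hc =>
  (definedLe_adjoinFun_iff hP).2 (.ret_pair (liftQ_app (h a c hc)))

theorem idQ_adjoinFun (a : A) : DefinedLe ((P.adjoinFun hP f).app P.idQ a) a :=
  (definedLe_adjoinFun_iff hP).2 (.ret_pair (idQ_app a []))

theorem constQ_adjoinFun (a : A) : ∃ v, DefinedLe ((P.adjoinFun hP f).app P.constQ a) v ∧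
    (P.adjoinFun hP f).Represents v (.const a) := by
  obtain ⟨v, hv, hva⟩ := constQ_app (P := P) a []
  refine ⟨v, (definedLe_adjoinFun_iff hP).2 (.ret_pair hv), fun x c hc => ?_⟩
  rw [Part.mem_some_iff.1 hc]
  exact (definedLe_adjoinFun_iff hP).2 (.ret_pair (hva _))

theorem forceQ_adjoinFun {b c : A} (h : DefinedLe ((P.adjoinFun hP f).app b P.i) c) :
    DefinedLe ((P.adjoinFun hP f).app P.forceQ b) c :=
  (definedLe_adjoinFun_iff hP).2 (((definedLe_adjoinFun_iff hP).1 h).of_kleeneLe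
    fun _ _ hx => forceQ_app (.of_mem hx))

theorem compQ_adjoinFun {s : A} {α : MonoPFun A} (hs : (P.adjoinFun hP f).Represents s α) :
    ∃ v, DefinedLe ((P.adjoinFun hP f).app P.compQ s) v ∧
      ∀ {t β}, (P.adjoinFun hP f).Represents t β →
        ∃ w, DefinedLe ((P.adjoinFun hP f).app v t) w ∧
          (P.adjoinFun hP f).Represents w (funApp hP α β) := by
  have key : ∀ {s : A} {α : MonoPFun A}, (P.adjoinFun hP f).Represents s α → ∀ a r,
      DefinedLe (α.toFun a) r → P.Dialogue f.toFun (fun l' => P.app s (P.code (a :: l'))) r := by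
    rintro s α hs a r ⟨c, hc, hcr⟩
    exact ((definedLe_adjoinFun_iff hP).1 (hs a c hc)).mono hcr
  obtain ⟨v, hv, hcomp⟩ := compQ_app (P := P) s []
  refine ⟨v, (definedLe_adjoinFun_iff hP).2 (.ret_pair hv), fun {t β} ht => ?_⟩
  obtain ⟨w, hw, hd⟩ := hcomp t []
  exact ⟨w, (definedLe_adjoinFun_iff hP).2 (.ret_pair hw), fun a c hc =>
    (definedLe_adjoinFun_iff hP).2 (hd (key hs) (key ht)
      ((definedLe_funApp_iff hP).1 (.of_mem hc)))⟩

/-! ### The two filters agree -/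

variable (f)

theorem isFilter_effectivelyRepresentable :
    (P.funPAP hP).IsFilter {α | (P.adjoinFun hP f).EffectivelyRepresentable α} where
  nonempty := ⟨f, P.copyQ, sharp_subset_adjoinFun hP f copyQ_mem, represents_copyQ hP⟩
  app_mem := by
    rintro α β γ ⟨s, hs, hsα⟩ ⟨t, ht, htβ⟩ hγ
    rw [mem_app_iff] at hγ
    subst hγ
    have hQ := (P.adjoinFun hP f).isFilter_sharp
    obtain ⟨v, ⟨v', hv', hv⟩, hvt⟩ := compQ_adjoinFun hP hsα
    obtain ⟨w, ⟨w', hw', hw⟩, hwr⟩ := hvt htβ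
    exact ⟨w, hQ.mem_of_le hw (hQ.app_mem (hQ.mem_of_le hv
      (hQ.app_mem (sharp_subset_adjoinFun hP f compQ_mem) hs hv')) ht hw'), hwr⟩
  mem_of_le := by
    rintro α β hαβ ⟨s, hs, hsα⟩
    exact ⟨s, hs, hsα.mono hαβ⟩

theorem const_mem_of_mem_sharp {a : A} (ha : a ∈ (P.adjoinFun hP f).sharp) :
    MonoPFun.const a ∈ (P.funAdjoinElem hP f).sharp := by
  have hF := (P.funAdjoinElem hP f).isFilter_sharp
  have hsub : ∀ a ∈ P.sharp, MonoPFun.const a ∈ (P.funAdjoinElem hP f).sharp := by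
    intro a ha
    -- The element k a represents the constant function â in A.
    refine PAP.subset_generate _ _ (Or.inl ⟨_, P.isFilter_sharp.app_mem P.k_mem ha
      (Part.get_mem (P.app_k_dom a)), fun b c hc => ?_⟩)
    rw [Part.mem_some_iff.1 hc]
    obtain ⟨x, hx, hxa⟩ := k_app (P := P) a b
    obtain ⟨y, hy, hyx⟩ := hx
    rw [Part.mem_unique (Part.get_mem (P.app_k_dom a)) hy]
    exact P.definedLe_app hxa hyx le_rfl
  refine ha {a | MonoPFun.const a ∈ (P.funAdjoinElem hP f).sharp}
    ⟨⟨⟨P.k, hsub _ P.k_mem⟩, ?_, ?_⟩, hsub⟩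
  · intro a b c ha hb hc
    exact hF.mem_of_le (funApp_appFun_le hP le_rfl le_rfl hc)
      (funApp_mem hP f (funApp_mem hP f (appFun_mem hP f) ha) hb)
  · intro a b hab ha
    exact hF.mem_of_le (MonoPFun.le_const_iff.2 fun x => definedLe_some.2 hab) ha

theorem effectivelyRepresentableVia_iff {α : MonoPFun A} :
    (P.adjoinFun hP f).EffectivelyRepresentableVia principal α ↔
      (P.adjoinFun hP f).EffectivelyRepresentable α :=
  exists_congr fun _ => and_congr_right fun _ => PAP.representsVia_principal_iff _

/-- Forwards, the representable functions form a filter containing the generators. Backwards,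
`counitFun` recovers α, up to ≤, from the constant function of a representer. -/
theorem mem_sharp_funAdjoinElem_iff {α : MonoPFun A} :
    α ∈ (P.funAdjoinElem hP f).sharp ↔ (P.adjoinFun hP f).EffectivelyRepresentable α := by
  constructor
  · intro h
    refine h _ ⟨isFilter_effectivelyRepresentable hP f, ?_⟩
    rintro β (⟨r, hr, hrβ⟩ | rfl)
    · exact ⟨_, sharp_subset_adjoinFun hP f (liftQ_mem hr), represents_liftQ hP hrβ⟩
    · exact ⟨_, sharp_subset_adjoinFun hP _ copyQ_mem, represents_copyQ hP⟩
  · rintro ⟨s, hs, hsα⟩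
    exact (P.funAdjoinElem hP f).isFilter_sharp.mem_of_le (funApp_counitFun_le hP le_rfl hsα)
      (funApp_mem hP f (counitFun_mem hP f) (const_mem_of_mem_sharp hP f hs))

/-! ### The adjunction -/

theorem isMorphism_const : (P.adjoinFun hP f).IsMorphism (P.funAdjoinElem hP f)
    (fun a => principal (MonoPFun.const a)) where
  sharp a ha := ⟨_, mem_principal.2 le_rfl, const_mem_of_mem_sharp hP f ha⟩
  tracker := by
    refine ⟨_, appFun_mem hP f, fun a a' c hc => PAP.definedLe_downApp_bind _ fun α hα =>
      ⟨_, .of_mem (funApp_mem_app hP _ α), fun β hβ =>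
        ⟨_, mem_principal.2 ?_, .of_mem (funApp_mem_app hP _ β)⟩⟩⟩
    exact funApp_appFun_le hP (mem_principal.1 hα) (mem_principal.1 hβ) hc
  order := by
    -- Definedness is trivial because application in 𝓑A is total; `copyQ` acts as an identity up to
    -- ≤.
    refine ⟨_, leftMul_mem hP f copyQ_mem, fun a => ⟨fun _ _ _ _ => trivial, fun b hab =>
      (PAP.definedLe_downApp_iff _).2 fun α hα => ⟨_, mem_principal.2 ?_,
        .of_mem (funApp_mem_app hP _ α)⟩⟩⟩
    exact (funApp_copyQ_le hP α).trans ((mem_principal.1 hα).trans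
      (MonoPFun.le_const_iff.2 fun x => definedLe_some.2 hab))

theorem isMorphism_representers : (P.funAdjoinElem hP f).IsMorphism (P.adjoinFun hP f)
    ((P.adjoinFun hP f).representers principal) where
  sharp α hα := by
    obtain ⟨s, hs, hsα⟩ := (mem_sharp_funAdjoinElem_iff hP f).1 hα
    exact ⟨s, (PAP.mem_representers_principal _).2 hsα, hs⟩
  tracker := by
    refine ⟨_, sharp_subset_adjoinFun hP f compQ_mem, fun α β γ hγ =>
      PAP.definedLe_downApp_bind _ fun s hs => ?_⟩
    obtain rfl := (mem_app_iff hP).1 hγ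
    obtain ⟨v, hv, hvt⟩ := compQ_adjoinFun hP ((PAP.mem_representers_principal _).1 hs)
    refine ⟨v, hv, fun t ht => ?_⟩
    obtain ⟨w, hw, hwr⟩ := hvt ((PAP.mem_representers_principal _).1 ht)
    exact ⟨w, (PAP.mem_representers_principal _).2 hwr, hw⟩
  order := by
    have h : ∀ α β : MonoPFun A, α ≤ β → DefinedLe ((P.adjoinFun hP f).downApp
        (LowerSet.Iic P.idQ) ((P.adjoinFun hP f).representers principal α))
        ((P.adjoinFun hP f).representers principal β) := fun α β hαβ =>
      (PAP.definedLe_downApp_iff _).2 fun s hs => ⟨s, (PAP.mem_representers_principal _).2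
        (((PAP.mem_representers_principal _).1 hs).mono hαβ), idQ_adjoinFun hP s⟩
    refine ⟨_, sharp_subset_adjoinFun hP f idQ_mem, fun α => ⟨?_, h α⟩⟩
    obtain ⟨x, hx, -⟩ := h α α le_rfl
    exact Part.dom_iff_mem.2 ⟨x, hx⟩

theorem unit_realized : (P.adjoinFun hP f).RealizedLe principal
    (compMorphism ((P.adjoinFun hP f).representers principal)
      (fun a => principal (MonoPFun.const a))) := by
  refine ⟨_, sharp_subset_adjoinFun hP f constQ_mem, fun a =>
    (PAP.definedLe_downApp_iff _).2 fun b hb => ?_⟩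
  obtain ⟨v, hv, hva⟩ := constQ_adjoinFun hP (f := f) a
  exact ⟨v, mem_compMorphism.2 ⟨_, mem_principal.2 le_rfl,
    (PAP.mem_representers_principal _).2 hva⟩,
    PAP.definedLe_app _ hv le_rfl (mem_principal.1 hb)⟩

theorem comp_realizedLe_principal : (P.adjoinFun hP f).RealizedLe
    (compMorphism ((P.adjoinFun hP f).representers principal)
      (fun a => principal (MonoPFun.const a))) principal := by
  refine ⟨_, sharp_subset_adjoinFun hP f forceQ_mem, fun a =>
    (PAP.definedLe_downApp_iff _).2 fun b hb => ⟨a, mem_principal.2 le_rfl, ?_⟩⟩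
  obtain ⟨β, hβ, hb⟩ := mem_compMorphism.1 hb
  exact forceQ_adjoinFun hP (((PAP.mem_representers_principal _).1 hb).mono (mem_principal.1 hβ)
    P.i a (Part.mem_some a))

theorem counit_realized : (P.funAdjoinElem hP f).RealizedLe
    (compMorphism (fun a => principal (MonoPFun.const a))
      ((P.adjoinFun hP f).representers principal)) principal := by
  refine ⟨_, counitFun_mem hP f, fun α => (PAP.definedLe_downApp_iff _).2 fun β hβ => ?_⟩
  obtain ⟨b, hb, hβ⟩ := mem_compMorphism.1 hβ
  exact ⟨_, mem_principal.2 (funApp_counitFun_le hP (mem_principal.1 hβ)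
    ((PAP.mem_representers_principal _).1 hb)), .of_mem (funApp_mem_app hP _ β)⟩

end PCA

theorem mainTheorem12 {A : Type*} [PartialOrder A] (P : PCA A) (hP : ¬ P.Semitrivial)
    (f : MonoPFun A) :
    {α : MonoPFun A | (P.adjoinFun hP f).EffectivelyRepresentableVia principal α} =
        (P.funPAP hP).generate (P.funSharp ∪ {f}) ∧
      IsAdjunction (P.adjoinFun hP f) (P.funAdjoinElem hP f)
        (fun a => principal (MonoPFun.const a))
        ((P.adjoinFun hP f).representers principal) ∧
      (P.adjoinFun hP f).Equivalent
        (compMorphism ((P.adjoinFun hP f).representers principal)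
          (fun a => principal (MonoPFun.const a)))
        principal := by
  refine ⟨Set.ext fun α => ?_, ⟨PCA.isMorphism_const hP f, PCA.isMorphism_representers hP f,
    PCA.unit_realized hP f, PCA.counit_realized hP f⟩, PCA.comp_realizedLe_principal hP f,
    PCA.unit_realized hP f⟩
  exact (PCA.effectivelyRepresentableVia_iff hP f).trans (PCA.mem_sharp_funAdjoinElem_iff hP f).symm
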